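/- Let $K$ be an even lattice of signature $(1,p-1)$, $p\ge 1$: a free $\mathbb Z$-module of rank $p$ with an integer-valued quadratic form $Q$ and bilinear form $(x,y)=Q(x+y)-Q(x)-Q(y)$, whose real extension has signature $(1,p-1)$. Let $K'=\{x\in K\otimes\mathbb Q : (x,y)\in\mathbb Z \text{ for all } y\in K\}$ be the dual lattice, and let $\Delta(K)$ be the discriminant kernel, i.e. the group of all $U\in \mathrm{O}(K)$ acting trivially on $K'/K$. Let $\mathcal C^+$ be one of the connected components of the cone $\{Y\in K\otimes\mathbb R : Q(Y)>0\}$, let $\overline{\mathcal C}^+$ be its closure and $\partial\mathcal C^+$ its boundary in $K\otimes\mathbb R$, and put $\mathcal H_z=\{Z\in K\otimes\mathbb C : \operatorname{Im} Z\in\mathcal C^+\}$. Let $\mathbb H$ be the upper half-plane and $\mathbb E$ the open unit disc. Let $m,N\ge 0$ and let $\Psi:\mathbb H^m\times\mathbb E^N\to\mathcal H_z$ be a holomorphic map such that for $i=1,\dots,m$ there are $U_i\in\Delta(K)$ and $T_i\in K$ with $$\Psi(\tau_1,\dots,\tau_i+1,\dots,\tau_m,w)=U_i\,\Psi(\tau_1,\dots,\tau_m,w)+T_i$$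 for all $(\tau,w)\in\mathbb H^m\times\mathbb E^N$. Then $U_1,\dots,U_m$ have finite order. Let $\ell\ge 1$ be the least common multiple of their orders. There exist vectors $\lambda_1,\dots,\lambda_m\in (K\otimes\mathbb Q)\cap\overline{\mathcal C}^+$ and a holomorphic map $\Psi_0:\mathbb E^m\times\mathbb E^N\to K\otimes\mathbb C$ such that $$\Psi(\tau_1,\dots,\tau_m,w)=\lambda_1\tau_1+\dots+\lambda_m\tau_m+\Psi_0\bigl(e^{2\pi i\tau_1/\ell},\dots,e^{2\pi i\tau_m/\ell},w\bigr)$$ for all $(\tau,w)\in\mathbb H^m\times\mathbb E^N$. Moreover, either $\Psi_0$ maps $\mathbb E^m\times\mathbb E^N$ into $\mathcal H_z$, or $\operatorname{Im}\Psi_0(q,w)\in\partial\mathcal C^+$ for all $(q,w)\in\mathbb E^m\times\mathbb E^N$. In particular $\operatorname{Im}\Psi_0$ always takes values in $\overline{\mathcal C}^+$. -/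

import Mathlib

open scoped TensorProduct

noncomputable section

namespace CurveLemma

/-! ### Even lattices

An even lattice is a free `ℤ`-module `K` of finite rank with an integer-valued quadratic form `Q`.
Its bilinear form is `(x, y) = Q (x + y) - Q x - Q y`, so that `Q x = (x, x) / 2`. -/

section Lattice

variable {K : Type*} [AddCommGroup K]

/-- The quadratic form on `K ⊗ ℝ` extending `Q`, namely `Y ↦ (Y, Y) / 2`. -/
def realForm (Q : QuadraticForm ℤ K) : QuadraticForm ℝ (ℝ ⊗[ℤ] K) :=
  (1 / 2 : ℝ) • LinearMap.BilinMap.toQuadraticMap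
    (LinearMap.BilinForm.baseChange ℝ (QuadraticMap.polarBilin Q))

theorem realForm_tmul (Q : QuadraticForm ℤ K) (x : K) :
    realForm Q (1 ⊗ₜ[ℤ] x) = (Q x : ℝ) := by
  simp [realForm, LinearMap.BilinMap.toQuadraticMap_apply]

/-- `K` is Lorentzian: it has signature `(1, p - 1)`, where `p` is the rank of `K`. -/
def IsLorentzian (Q : QuadraticForm ℤ K) : Prop :=
  sigPos (realForm Q) = 1 ∧ sigNeg (realForm Q) + 1 = Module.finrank ℤ K

/-- The image of `K` in `K ⊗ ℚ`. -/
def latticeInRat (K : Type*) [AddCommGroup K] : AddSubgroup (ℚ ⊗[ℤ] K) :=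
  (TensorProduct.mk ℤ ℚ K 1).toAddMonoidHom.range

theorem mem_latticeInRat {x : ℚ ⊗[ℤ] K} :
    x ∈ latticeInRat K ↔ ∃ y : K, (1 : ℚ) ⊗ₜ[ℤ] y = x := Iff.rfl

/-- The dual lattice `K' = {x ∈ K ⊗ ℚ : (x, y) ∈ ℤ for all y ∈ K}`. -/
def dualLattice (Q : QuadraticForm ℤ K) : Set (ℚ ⊗[ℤ] K) :=
  {x | ∀ y : K, ∃ n : ℤ,
    LinearMap.BilinForm.baseChange ℚ (QuadraticMap.polarBilin Q) x (1 ⊗ₜ[ℤ] y) = n}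

/-- The action of an automorphism of `K` on `K ⊗ R`. -/
def scalarAct (R : Type*) [CommRing R] (U : K ≃ₗ[ℤ] K) : R ⊗[ℤ] K →ₗ[R] R ⊗[ℤ] K :=
  LinearMap.baseChange R (U : K →ₗ[ℤ] K)

theorem scalarAct_mul (R : Type*) [CommRing R] (U V : K ≃ₗ[ℤ] K) (x : R ⊗[ℤ] K) :
    scalarAct R (U * V) x = scalarAct R U (scalarAct R V x) := by
  induction x with
  | zero => simp
  | tmul a y => simp [scalarAct]
  | add a b ha hb => simp only [map_add, ha, hb]

theorem scalarAct_one (R : Type*) [CommRing R] (x : R ⊗[ℤ] K) :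
    scalarAct R (1 : K ≃ₗ[ℤ] K) x = x := by
  induction x with
  | zero => simp
  | tmul a y => simp [scalarAct]
  | add a b ha hb => simp only [map_add, ha, hb]

theorem scalarAct_mem_latticeInRat (U : K ≃ₗ[ℤ] K) {x : ℚ ⊗[ℤ] K} (hx : x ∈ latticeInRat K) :
    scalarAct ℚ U x ∈ latticeInRat K := by
  obtain ⟨y, rfl⟩ := mem_latticeInRat.1 hx
  exact mem_latticeInRat.2 ⟨U y, by simp [scalarAct]⟩

/-- The orthogonal group `O(K)`. -/
def orthogonalGroup (Q : QuadraticForm ℤ K) : Subgroup (K ≃ₗ[ℤ] K) where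
  carrier := {U | ∀ x, Q (U x) = Q x}
  mul_mem' {U V} hU hV x := by
    rw [LinearEquiv.mul_apply, hU, hV]
  one_mem' _ := rfl
  inv_mem' {U} hU x := by
    have h := hU (U⁻¹ x)
    rwa [← LinearEquiv.mul_apply, mul_inv_cancel, LinearEquiv.coe_one, id, eq_comm] at h

/-- The discriminant kernel `Δ(K)`: the elements of `O(K)` that act trivially on `K' / K`. -/
def discriminantKernel (Q : QuadraticForm ℤ K) : Subgroup (K ≃ₗ[ℤ] K) where
  carrier := {U | U ∈ orthogonalGroup Q ∧
    ∀ x ∈ dualLattice Q, scalarAct ℚ U x - x ∈ latticeInRat K}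
  mul_mem' {U V} hU hV := by
    refine ⟨mul_mem hU.1 hV.1, fun x hx => ?_⟩
    have h := add_mem (scalarAct_mem_latticeInRat U (hV.2 x hx)) (hU.2 x hx)
    rwa [map_sub, sub_add_sub_cancel, ← scalarAct_mul] at h
  one_mem' := ⟨one_mem _, fun x _ => by rw [scalarAct_one, sub_self]; exact zero_mem _⟩
  inv_mem' {U} hU := by
    refine ⟨inv_mem hU.1, fun x hx => ?_⟩
    have h := neg_mem (scalarAct_mem_latticeInRat U⁻¹ (hU.2 x hx))
    rwa [map_sub, ← scalarAct_mul, inv_mul_cancel, scalarAct_one, neg_sub] at h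

end Lattice

/-! ### The positive cone and the tube domain -/

section Tube

variable {K : Type*} [AddCommGroup K]

/-- The canonical topology of the real vector space `K ⊗ ℝ`; for `K` of finite rank it is the
usual one. -/
instance : TopologicalSpace (ℝ ⊗[ℤ] K) := moduleTopology ℝ (ℝ ⊗[ℤ] K)

instance : IsModuleTopology ℝ (ℝ ⊗[ℤ] K) := ⟨rfl⟩

/-- The cone `C` of vectors of positive norm in `K ⊗ ℝ`. -/
def positiveVectors (Q : QuadraticForm ℤ K) : Set (ℝ ⊗[ℤ] K) := {Y | 0 < realForm Q Y}

/-- `C⁺` is one of the connected components of the cone of vectors of positive norm. -/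
def IsPositiveCone (Q : QuadraticForm ℤ K) (Cplus : Set (ℝ ⊗[ℤ] K)) : Prop :=
  ∃ Y ∈ positiveVectors Q, Cplus = connectedComponentIn (positiveVectors Q) Y

/-- The imaginary part `K ⊗ ℂ → K ⊗ ℝ`. -/
def imPart : ℂ ⊗[ℤ] K →+ ℝ ⊗[ℤ] K :=
  (LinearMap.rTensor K Complex.imAddGroupHom.toIntLinearMap).toAddMonoidHom

theorem imPart_tmul (a : ℂ) (x : K) : imPart (a ⊗ₜ[ℤ] x) = a.im ⊗ₜ[ℤ] x := rfl

/-- The inclusion `K ⊗ ℝ → K ⊗ ℂ`. -/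
def realToComplex : ℝ ⊗[ℤ] K →+ ℂ ⊗[ℤ] K :=
  (LinearMap.rTensor K (Complex.ofRealHom : ℝ →+ ℂ).toIntLinearMap).toAddMonoidHom

theorem realToComplex_tmul (a : ℝ) (x : K) :
    realToComplex (a ⊗ₜ[ℤ] x) = (a : ℂ) ⊗ₜ[ℤ] x := rfl

/-- The inclusion `K ⊗ ℚ → K ⊗ ℝ`. -/
def ratToReal : ℚ ⊗[ℤ] K →+ ℝ ⊗[ℤ] K :=
  (LinearMap.rTensor K (Rat.castHom ℝ : ℚ →+ ℝ).toIntLinearMap).toAddMonoidHom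

theorem ratToReal_tmul (a : ℚ) (x : K) : ratToReal (a ⊗ₜ[ℤ] x) = (a : ℝ) ⊗ₜ[ℤ] x := rfl

/-- The subspace `K ⊗ ℚ` of `K ⊗ ℝ`. -/
def rationalVectors (K : Type*) [AddCommGroup K] : Set (ℝ ⊗[ℤ] K) :=
  Set.range (ratToReal : ℚ ⊗[ℤ] K →+ ℝ ⊗[ℤ] K)

/-- The tube domain `{Z ∈ K ⊗ ℂ : Im Z ∈ C⁺}`. -/
def tubeDomain (Cplus : Set (ℝ ⊗[ℤ] K)) : Set (ℂ ⊗[ℤ] K) := {Z | imPart Z ∈ Cplus}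

end Tube

/-! ### Domains and holomorphic maps -/

/-- A map from an open subset `D` of a complex normed space to a finite-dimensional complex vector
space is holomorphic if all its coordinates (equivalently, its compositions with all linear
functionals) are. -/
def IsHolomorphicOn {E M : Type*} [NormedAddCommGroup E] [NormedSpace ℂ E] [AddCommGroup M]
    [Module ℂ M] (f : E → M) (D : Set E) : Prop :=
  ∀ φ : M →ₗ[ℂ] ℂ, DifferentiableOn ℂ (fun x => φ (f x)) D

/-- `ℍ^m × 𝔼^N`, with `ℍ` the upper half-plane and `𝔼` the open unit disc. -/
def halfPlanesTimesDiscs (m N : ℕ) : Set ((Fin m → ℂ) × (Fin N → ℂ)) :=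
  {x | (∀ i, 0 < (x.1 i).im) ∧ ∀ j, ‖x.2 j‖ < 1}

/-- `𝔼^m × 𝔼^N`. -/
def discsTimesDiscs (m N : ℕ) : Set ((Fin m → ℂ) × (Fin N → ℂ)) :=
  {x | (∀ i, ‖x.1 i‖ < 1) ∧ ∀ j, ‖x.2 j‖ < 1}

end CurveLemma

end

namespace CurveLemma

/-! ### Functions of positive imaginary part on the upper half-plane -/

section HalfPlane
open Complex Metric Set Filter Topology ComplexConjugate

/-! Finite order. Freezing all variables but one gives a curve ψ in the tube domain with ψ(z + 1) =
Uψ(z) + T. Put Y = Im ψ and y₁ = Y(i). The function (y₁, Y) is the positive imaginary part of a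
holomorphic function, so Harnack's inequality (`im_le_mul_im_of_im_pos`) bounds (y₁, Uⁿy₁)
quadratically in n. Positivity on the cone passes this bound to all matrix entries of Uⁿ, and
Kronecker's theorem makes some power v = U^l unipotent (`exists_pow_sub_one_isNilpotent`). In
Lorentzian signature N = v - 1 satisfies N³ = 0 (`sub_one_cube_eq_zero`). Now N²Y/2 is the leading
coefficient in n of vⁿY, hence N²Y lies in the closed cone. The function (y₁, N²Y) is non-negative,
l-periodic and, by Harnack again, O(1/y) on the imaginary axis. If it were everywhere positive,
Phragmén–Lindelöf would bound it below on that axis, so it vanishes at some z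
(`exists_im_eq_zero_of_periodic`). There N²Y(z) = 0, and since Y(z) has positive norm this forces v
= 1 (`eq_one_of_sq_apply_eq_zero`).

Normal form. For ℓ the least common multiple of the orders, translating τᵢ by ℓ adds a lattice
vector T'ᵢ to Ψ; put λᵢ = T'ᵢ / ℓ. For w in the cone, Schwarz–Pick gives (w, λᵢ) ≥ 0 and Im (w, Ψ) ≥
Σ (w, λᵢ) Im τᵢ (`im_ge_sum_of_translate`). By self-duality of the cone, λᵢ lies in its closure. The
periodic remainder, paired with w, has non-negative imaginary part, so its Cayley transform is
bounded and extends over the punctures (`exists_eq_comp_qMap`). Vectors of the cone span, which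
yields Ψ₀; density and self-duality put Im Ψ₀ in the closed cone. The final alternative is the
maximum principle for exp(iφ(Ψ₀)), with φ a supporting functional of the cone at a boundary value
(`mem_formCone_or_not_mem`). -/

theorem normSq_sub_conj (z w : ℂ) : normSq (z - conj w) = normSq (z - w) + 4 * (z.im * w.im) := by
  simp only [normSq_apply, sub_re, sub_im, conj_re, conj_im]; ring

theorem sub_conj_ne_zero {z w : ℂ} (hz : 0 < z.im) (hw : 0 < w.im) : z - conj w ≠ 0 := by
  intro h
  have := congrArg Complex.im h
  simp at this
  linarith

/-- The **Schwarz–Pick lemma** for the upper half-plane. -/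
theorem schwarzPick_of_im_pos {g : ℂ → ℂ} (hg : DifferentiableOn ℂ g {z | 0 < z.im})
    (hpos : ∀ z : ℂ, 0 < z.im → 0 < (g z).im) {z w : ℂ} (hz : 0 < z.im) (hw : 0 < w.im) :
    normSq (g z - g w) * (z.im * w.im) ≤ normSq (z - w) * ((g z).im * (g w).im) := by
  -- The Cayley map from the disc to the half-plane with `p 0 = w`. Composing `g` with it and with
  -- the inverse Cayley map at `g w` reduces the claim to the Schwarz lemma at 0.
  set p : ℂ → ℂ := fun ζ => (w - conj w * ζ) / (1 - ζ) with hp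
  have hne : ∀ ζ ∈ ball (0 : ℂ) 1, 1 - ζ ≠ 0 := by
    intro ζ hζ h
    rw [mem_ball_zero_iff, ← sub_eq_zero.1 h] at hζ
    simp at hζ
  have hp_im : ∀ ζ ∈ ball (0 : ℂ) 1, 0 < (p ζ).im := by
    intro ζ hζ
    have h1 : p ζ = ((w - conj w * ζ) * conj (1 - ζ)) / (normSq (1 - ζ) : ℝ) := by
      rw [hp, normSq_eq_conj_mul_self, mul_comm (conj (1 - ζ)),
        mul_div_mul_right _ _ ((map_ne_zero _).2 (hne ζ hζ))]
    have h2 : 0 < normSq (1 - ζ) := normSq_pos.2 (hne ζ hζ)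
    have h3 : normSq ζ < 1 := by
      rw [normSq_eq_norm_sq]
      have := mem_ball_zero_iff.1 hζ
      have := norm_nonneg ζ
      nlinarith
    rw [h1, div_ofReal_im]
    apply div_pos _ h2
    have : ((w - conj w * ζ) * conj (1 - ζ)).im = w.im * (1 - normSq ζ) := by
      simp [normSq_apply]; ring
    rw [this]
    exact mul_pos hw (by linarith)
  have hpd : DifferentiableOn ℂ p (ball 0 1) := by
    intro ζ hζ
    have := hne ζ hζ
    exact DifferentiableAt.differentiableWithinAt (by fun_prop (disch := assumption))
  set G : ℂ → ℂ := fun ζ => (g (p ζ) - g w) / (g (p ζ) - conj (g w)) with hG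
  have hgp : DifferentiableOn ℂ (fun ζ => g (p ζ)) (ball 0 1) := hg.comp hpd hp_im
  have hGd : DifferentiableOn ℂ G (ball 0 1) := by
    refine (hgp.sub_const _).div (hgp.sub_const _) fun ζ hζ => ?_
    exact sub_conj_ne_zero (hpos _ (hp_im ζ hζ)) (hpos w hw)
  have hGm : MapsTo G (ball 0 1) (closedBall 0 1) := by
    intro ζ hζ
    rw [mem_closedBall_zero_iff, hG, norm_div]
    have h1 := hpos _ (hp_im ζ hζ)
    have h2 := hpos w hw
    apply div_le_one_of_le₀ _ (norm_nonneg _)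
    rw [← sq_le_sq₀ (norm_nonneg _) (norm_nonneg _), ← normSq_eq_norm_sq, ← normSq_eq_norm_sq,
      normSq_sub_conj]
    nlinarith [mul_pos h1 h2]
  have hp0 : p 0 = w := by simp [hp]
  have hG0 : G 0 = 0 := by simp [hG, hp0]
  set ζ : ℂ := (z - w) / (z - conj w) with hζ
  have hzw := sub_conj_ne_zero hz hw
  have hpz : p ζ = z := by
    have h1 : 1 - ζ = (w - conj w) / (z - conj w) := by rw [hζ]; field_simp; ring
    have h2 : w - conj w * ζ = z * (w - conj w) / (z - conj w) := by rw [hζ]; field_simp; ring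
    have h3 : w - conj w ≠ 0 := sub_conj_ne_zero hw hw
    rw [hp]
    simp only
    rw [h1, h2]
    field_simp
  have hn : normSq ζ = normSq (z - w) / (normSq (z - w) + 4 * (z.im * w.im)) := by
    rw [hζ, map_div₀, normSq_sub_conj]
  have hzwp := mul_pos hz hw
  have hnn := normSq_nonneg (z - w)
  have hlt : ‖ζ‖ < 1 := by
    rw [← sq_lt_one_iff₀ (norm_nonneg _), ← normSq_eq_norm_sq, hn, div_lt_one (by linarith)]
    linarith
  have key := norm_le_norm_of_mapsTo_ball hGd hGm hG0 hlt
  have hGζ : G ζ = (g z - g w) / (g z - conj (g w)) := by simp only [hG, hpz]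
  have hgg := mul_pos (hpos z hz) (hpos w hw)
  have hnn' := normSq_nonneg (g z - g w)
  rw [← sq_le_sq₀ (norm_nonneg _) (norm_nonneg _), ← normSq_eq_norm_sq, ← normSq_eq_norm_sq, hn,
    hGζ, map_div₀, normSq_sub_conj, div_le_div_iff₀ (by linarith) (by linarith)] at key
  nlinarith

/-- Apply the strict version to g + iε and let ε tend to 0. -/
theorem schwarzPick_of_im_nonneg {g : ℂ → ℂ} (hg : DifferentiableOn ℂ g {z | 0 < z.im})
    (hpos : ∀ z : ℂ, 0 < z.im → 0 ≤ (g z).im) {z w : ℂ} (hz : 0 < z.im) (hw : 0 < w.im) :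
    normSq (g z - g w) * (z.im * w.im) ≤ normSq (z - w) * ((g z).im * (g w).im) := by
  have key : ∀ ε : ℝ, 0 < ε → normSq (g z - g w) * (z.im * w.im) ≤
      normSq (z - w) * (((g z).im + ε) * ((g w).im + ε)) := by
    intro ε hε
    have := schwarzPick_of_im_pos (g := fun z => g z + ε * I) (hg.add_const _)
      (fun z hz => by have := hpos z hz; simp; linarith) hz hw
    simpa using this
  have hlim : Tendsto (fun ε : ℝ => normSq (z - w) * (((g z).im + ε) * ((g w).im + ε)))
      (𝓝[>] 0) (𝓝 (normSq (z - w) * (((g z).im + 0) * ((g w).im + 0)))) :=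
    Tendsto.mono_left (Continuous.tendsto (by fun_prop) 0) nhdsWithin_le_nhds
  have := ge_of_tendsto hlim (eventually_mem_nhdsWithin.mono fun ε hε => key ε hε)
  simpa using this

/-- A **Harnack inequality** for the imaginary part of a holomorphic function on the upper
half-plane. -/
theorem im_le_mul_im_of_im_pos {g : ℂ → ℂ} (hg : DifferentiableOn ℂ g {z | 0 < z.im})
    (hpos : ∀ z : ℂ, 0 < z.im → 0 < (g z).im) {z w : ℂ} (hz : 0 < z.im) (hw : 0 < w.im) :
    (g z).im ≤ (2 + normSq (z - w) / (z.im * w.im)) * (g w).im := by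
  have h := schwarzPick_of_im_pos hg hpos hz hw
  have hp := mul_pos hz hw
  have h1 := hpos z hz
  have h2 := hpos w hw
  set D := normSq (z - w) / (z.im * w.im) with hD
  have hD' : normSq (z - w) = D * (z.im * w.im) := by rw [hD]; field_simp
  rw [hD', mul_right_comm, mul_le_mul_iff_left₀ hp] at h
  have h3 : ((g z).im - (g w).im) ^ 2 ≤ normSq (g z - g w) := by
    rw [normSq_apply, sub_re, sub_im]; nlinarith [mul_self_nonneg ((g z).re - (g w).re)]
  -- With a = Im g(z) and b = Im g(w), expanding (a - b)² ≤ D a b and dropping b² gives a² ≤ (2 + D)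
  -- a b.
  have h4 : (g z).im * (g z).im ≤ (g z).im * ((2 + D) * (g w).im) := by nlinarith
  exact le_of_mul_le_mul_left h4 h1

/-- Schwarz–Pick for the pair z + l, z: since `t` is real, `g` has the same imaginary part at both
points. -/
theorem abs_mul_im_le_of_translate {g : ℂ → ℂ} (hg : DifferentiableOn ℂ g {z | 0 < z.im})
    (hpos : ∀ z : ℂ, 0 < z.im → 0 ≤ (g z).im) {l t : ℝ} (hl : 0 < l)
    (hgt : ∀ z : ℂ, 0 < z.im → g (z + l) = g z + l * t) {z : ℂ} (hz : 0 < z.im) :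
    |t| * z.im ≤ (g z).im := by
  have h := schwarzPick_of_im_nonneg hg hpos (z := z + l) (w := z) (by simpa using hz) hz
  rw [hgt z hz, add_sub_cancel_left, add_sub_cancel_left] at h
  simp only [normSq_mul, normSq_ofReal, add_im, ofReal_im, add_zero, mul_im, ofReal_re, mul_zero,
    zero_mul] at h
  have h1 : (|t| * z.im) ^ 2 ≤ (g z).im ^ 2 := by
    rw [mul_pow, sq_abs]
    exact le_of_mul_le_mul_left (a := l * l) (by nlinarith) (by positivity)
  exact (sq_le_sq₀ (by positivity) (hpos z hz)).1 h1

/-- If `g` has non-negative imaginary part on the upper half-plane and `g (z + l) = g z + l t`,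
then `t ≥ 0` and even `g z - t z` has non-negative imaginary part. -/
theorem im_ge_of_translate {g : ℂ → ℂ} (hg : DifferentiableOn ℂ g {z | 0 < z.im})
    (hpos : ∀ z : ℂ, 0 < z.im → 0 ≤ (g z).im) {l t : ℝ} (hl : 0 < l)
    (hgt : ∀ z : ℂ, 0 < z.im → g (z + l) = g z + l * t) :
    0 ≤ t ∧ ∀ z : ℂ, 0 < z.im → t * z.im ≤ (g z).im := by
  have ht : 0 ≤ t := by
    by_contra! ht
    -- If t < 0, then g + tz still has non-negative imaginary part by the previous bound, and its
    -- translation constant is 2t. Iterating this forces Im g(i) above every multiple of -t.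
    have key : ∀ (k : ℕ) (g : ℂ → ℂ) (t : ℝ), DifferentiableOn ℂ g {z | 0 < z.im} →
        (∀ z : ℂ, 0 < z.im → 0 ≤ (g z).im) → t < 0 →
        (∀ z : ℂ, 0 < z.im → g (z + l) = g z + l * t) → (k : ℝ) * (-t) ≤ (g I).im := by
      intro k
      induction k with
      | zero => intro g t _ h _ _; simpa using h I (by simp)
      | succ k ih =>
        intro g t hg hpos ht hgt
        have h1 := fun z hz => abs_mul_im_le_of_translate hg hpos hl hgt (z := z) hz
        rw [abs_of_neg ht] at h1
        have h2 := ih (fun z => g z + t * z) (2 * t)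
          (hg.add (differentiable_id.const_mul _).differentiableOn)
          (fun z hz => by have := h1 z hz; simp; linarith) (by linarith)
          (fun z hz => by simp only [hgt z hz]; push_cast; ring)
        simp at h2
        push_cast
        nlinarith [mul_nonneg (Nat.cast_nonneg (α := ℝ) k) (neg_nonneg.2 ht.le)]
    obtain ⟨k, hk⟩ := exists_nat_gt ((g I).im / (-t))
    rw [div_lt_iff₀ (by linarith)] at hk
    exact absurd (key k g t hg hpos ht hgt) (not_le.2 hk)
  refine ⟨ht, fun z hz => ?_⟩
  simpa [abs_of_nonneg ht] using abs_mul_im_le_of_translate hg hpos hl hgt hz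

/-- If the imaginary part of `F` is non-negative on the upper half-plane, periodic, and tends to
zero along the imaginary axis like `1 / y`, then it vanishes somewhere. -/
theorem exists_im_eq_zero_of_periodic {F : ℂ → ℂ} (hF : DifferentiableOn ℂ F {z | 0 < z.im})
    (hnn : ∀ z : ℂ, 0 < z.im → 0 ≤ (F z).im) {l : ℝ} (hl : 0 < l)
    (hper : ∀ z : ℂ, 0 < z.im → (F (z + l)).im = (F z).im) {C : ℝ}
    (hC : ∀ y : ℝ, 1 ≤ y → (F (y * I)).im ≤ C / y) :
    ∃ z : ℂ, 0 < z.im ∧ (F z).im = 0 := by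
  -- Otherwise periodicity gives a positive minimum `c` on the line Im z = 1, and Phragmén–Lindelöf
  -- for exp(iF) carries the bound `c` up the imaginary axis, against the decay C / y.
  by_contra! hne
  have hpos : ∀ z : ℂ, 0 < z.im → 0 < (F z).im := fun z hz =>
    lt_of_le_of_ne (hnn z hz) (hne z hz).symm
  have hcont : ContinuousOn (fun x : ℝ => (F (x + I)).im) univ := by
    refine continuous_im.comp_continuousOn (hF.continuousOn.comp (by fun_prop) ?_)
    intro x _
    simp
  have hper' : Function.Periodic (fun x : ℝ => (F (x + I)).im) l := by
    intro x
    have := hper (x + I) (by simp)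
    change (F (((x + l : ℝ) : ℂ) + I)).im = _
    rwa [show ((x + l : ℝ) : ℂ) + I = x + I + l by push_cast; ring]
  obtain ⟨x₀, -, hx₀⟩ := isCompact_Icc.exists_isMinOn (nonempty_Icc.2 hl.le)
    (hcont.mono (subset_univ (Icc 0 l)))
  set c := (F (x₀ + I)).im with hc
  have hc0 : 0 < c := hpos _ (by simp)
  have hline : ∀ x : ℝ, c ≤ (F (x + I)).im := by
    intro x
    obtain ⟨y, hy, hxy⟩ := hper'.exists_mem_Ico₀ hl x
    exact le_of_le_of_eq (hx₀ (Ico_subset_Icc_self hy)) hxy.symm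
  have hupper : ∀ y : ℝ, 1 ≤ y → c ≤ (F (y * I)).im := by
    intro y hy
    -- The map z ↦ I + I z sends the right half-plane to Im > 1 and the imaginary axis to the line
    -- Im = 1.
    have hmap : ∀ z : ℂ, 0 ≤ z.re → 0 < (I + I * z).im := fun z hz => by simp; linarith
    have hFd : DifferentiableOn ℂ (fun z => cexp (I * F (I + I * z))) {z | -1 < z.re} := by
      refine DifferentiableOn.cexp (DifferentiableOn.const_mul (hF.comp (by fun_prop) ?_) _)
      intro z (hz : -1 < z.re)
      simp; linarith
    have hnorm : ∀ z, ‖cexp (I * F (I + I * z))‖ = Real.exp (-(F (I + I * z)).im) := by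
      intro z; rw [norm_exp]; simp
    have hle1 : ∀ z : ℂ, 0 ≤ z.re → ‖cexp (I * F (I + I * z))‖ ≤ 1 := by
      intro z hz
      rw [hnorm, Real.exp_le_one_iff]
      linarith [hpos _ (hmap z hz)]
    have hsub : closure {z : ℂ | 0 < z.re} ⊆ {z | -1 < z.re} := by
      rw [closure_setOfPred_lt_re]
      intro z (hz : 0 ≤ z.re)
      simp only [mem_ofPred_eq]; linarith
    have := PhragmenLindelof.right_half_plane_of_bounded_on_real
      (f := fun z => cexp (I * F (I + I * z))) (C := Real.exp (-c)) (z := ((y - 1 : ℝ) : ℂ))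
      ((hFd.mono hsub).diffContOnCl)
      ⟨1, by norm_num, 0, by
        refine Asymptotics.IsBigO.of_bound 1 ?_
        filter_upwards [mem_inf_of_right (mem_principal_self _)] with z hz
        simpa using hle1 z (le_of_lt hz)⟩
      ⟨1, by
        rw [eventually_map]
        filter_upwards [eventually_ge_atTop 0] with x hx using hle1 x (by simpa using hx)⟩
      (fun x => by
        rw [hnorm, Real.exp_le_exp, neg_le_neg_iff]
        have : I + I * (x * I) = ((-x : ℝ) : ℂ) + I := by
          push_cast; ring_nf; rw [I_sq]; ring
        rw [this]
        exact hline (-x))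
      (by simpa using hy)
    rw [hnorm, Real.exp_le_exp, neg_le_neg_iff] at this
    have e : I + I * ((y - 1 : ℝ) : ℂ) = y * I := by push_cast; ring
    rwa [e] at this
  have hy : (1 : ℝ) ≤ max 1 (2 * C / c) := le_max_left _ _
  have h1 := (hupper _ hy).trans (hC _ hy)
  have h2 : 2 * C / c ≤ max 1 (2 * C / c) := le_max_right _ _
  rw [le_div_iff₀ (by linarith)] at h1
  rw [div_le_iff₀ hc0] at h2
  have : 0 < c * max 1 (2 * C / c) := mul_pos hc0 (by linarith)
  nlinarith

end HalfPlane

/-! ### Geometry of the Lorentzian cone and its unipotent isometries -/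

section Hyperbolic
variable {V : Type*} [AddCommGroup V] [Module ℝ V]

/-- A symmetric bilinear form is hyperbolic if the orthogonal complement of every vector of
positive norm is negative definite. -/
structure IsHyperbolic (B : LinearMap.BilinForm ℝ V) : Prop where
  symm : ∀ x y, B x y = B y x
  neg : ∀ y, 0 < B y y → ∀ z, B y z = 0 → z ≠ 0 → B z z < 0

/-- The component of `y₀` of the cone of vectors of positive norm. -/
def formCone (B : LinearMap.BilinForm ℝ V) (y₀ : V) : Set V := {y | 0 < B y y ∧ 0 < B y₀ y}

/-- The closure of `formCone B y₀`. -/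
def closedFormCone (B : LinearMap.BilinForm ℝ V) (y₀ : V) : Set V := {y | 0 ≤ B y y ∧ 0 ≤ B y₀ y}

namespace IsHyperbolic
variable {B : LinearMap.BilinForm ℝ V} (hB : IsHyperbolic B)
include hB

theorem nonpos {y z : V} (hy : 0 < B y y) (hz : B y z = 0) : B z z ≤ 0 := by
  by_cases h : z = 0
  · simp [h]
  · exact (hB.neg y hy z hz h).le

theorem eq_zero_of_nonneg {y z : V} (hy : 0 < B y y) (hz : B y z = 0) (hzz : 0 ≤ B z z) :
    z = 0 := by
  by_contra h
  exact absurd (hB.neg y hy z hz h) (not_lt.2 hzz)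

/-- Reverse Cauchy–Schwarz: B(y₀, z) y - B(y₀, y) z is orthogonal to `y₀`, so its norm is at most 0,
and expanding isolates a positive multiple of B(z, y). -/
theorem pos_of_mem {y₀ y z : V} (hy₀ : 0 < B y₀ y₀) (hy : y ∈ closedFormCone B y₀) (hy0 : y ≠ 0)
    (hz : z ∈ formCone B y₀) : 0 < B z y := by
  have ha : 0 < B y₀ y := lt_of_le_of_ne hy.2 fun h =>
    hy0 (hB.eq_zero_of_nonneg hy₀ h.symm hy.1)
  have h := hB.nonpos hy₀ (z := B y₀ z • y - B y₀ y • z) (by simp; ring)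
  simp [hB.symm y z] at h
  have h1 := mul_pos (mul_pos ha ha) hz.1
  have h2 := mul_nonneg (mul_pos hz.2 hz.2).le hy.1
  have h3 : 0 < (B y₀ z * B y₀ y) * B z y := by nlinarith
  exact pos_of_mul_pos_right h3 (mul_pos hz.2 ha).le

omit hB in
theorem formCone_subset (y₀ : V) : formCone B y₀ ⊆ closedFormCone B y₀ :=
  fun _ h => ⟨h.1.le, h.2.le⟩

omit hB in
theorem ne_zero_of_mem {y₀ y : V} (hy : y ∈ formCone B y₀) : y ≠ 0 := by
  rintro rfl
  simpa using hy.1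

theorem pos_of_mem_formCone {y₀ y z : V} (hy₀ : 0 < B y₀ y₀) (hy : y ∈ formCone B y₀)
    (hz : z ∈ formCone B y₀) : 0 < B z y :=
  hB.pos_of_mem hy₀ (formCone_subset y₀ hy) (ne_zero_of_mem hy) hz

theorem nonneg_of_mem {y₀ y z : V} (hy₀ : 0 < B y₀ y₀) (hy : y ∈ closedFormCone B y₀)
    (hz : z ∈ formCone B y₀) : 0 ≤ B z y := by
  by_cases h : y = 0
  · simp [h]
  · exact (hB.pos_of_mem hy₀ hy h hz).le

/-- The cone is self-dual. -/
theorem mem_closedFormCone {y₀ x : V} (hy₀ : 0 < B y₀ y₀)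
    (h : ∀ w ∈ formCone B y₀, 0 ≤ B w x) : x ∈ closedFormCone B y₀ := by
  have ha : 0 ≤ B y₀ x := h y₀ ⟨hy₀, hy₀⟩
  refine ⟨?_, ha⟩
  by_contra! hx
  set q := B y₀ y₀
  set a := B y₀ x
  have hD : a ^ 2 < a ^ 2 - q * B x x := by nlinarith
  -- Test against t y₀ + (q x - a y₀), whose second summand is orthogonal to `y₀`. With D = a² - q
  -- B(x, x), its norm is q(t² - D) and its pairing with `x` is t a - D.
  have key : ∀ t : ℝ, 0 < t → a ^ 2 - q * B x x < t ^ 2 → a ^ 2 - q * B x x ≤ t * a := by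
    intro t ht hlt
    have := h (t • y₀ + (q • x - a • y₀)) ⟨by
      simp only [map_add, map_sub, map_smul, LinearMap.add_apply, LinearMap.sub_apply,
        LinearMap.smul_apply, smul_eq_mul, hB.symm x y₀]
      change 0 < t * (t * q + (q * a - a * q)) + (q * (t * a + (q * B x x - a * a)) -
        a * (t * q + (q * a - a * q)))
      nlinarith [mul_pos hy₀ (sub_pos.2 hlt)], by
      simp only [map_add, map_sub, map_smul, smul_eq_mul]
      change 0 < t * q + (q * a - a * q)
      nlinarith⟩
    simp only [map_add, map_sub, map_smul, LinearMap.add_apply, LinearMap.sub_apply,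
        LinearMap.smul_apply, smul_eq_mul] at this
    change 0 ≤ t * a + (q * B x x - a * a) at this
    linarith
  set D := a ^ 2 - q * B x x
  have hD0 : 0 < D := lt_of_le_of_lt (sq_nonneg a) hD
  rcases ha.eq_or_lt with h0 | h0
  · have := key (D + 1) (by linarith) (by nlinarith)
    rw [← h0] at this
    linarith
  -- This t is the arithmetic mean of D / a and a, so t² exceeds D; yet t a = (D + a²) / 2 < D.
  · have h1 : 0 < (D / a + a) / 2 := by positivity
    have h2 : (D / a + a) / 2 * a = (D + a ^ 2) / 2 := by field_simp
    have h3 : D < ((D / a + a) / 2) ^ 2 := by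
      have : ((D / a + a) / 2) ^ 2 - D = ((D - a ^ 2) / (2 * a)) ^ 2 := by field_simp; ring
      have h4 : 0 < ((D - a ^ 2) / (2 * a)) ^ 2 := by
        have : 0 < D - a ^ 2 := by linarith
        positivity
      linarith
    have := key _ h1 h3
    rw [h2] at this
    linarith

theorem eq_zero_of_forall {y₀ x : V} (hy₀ : 0 < B y₀ y₀) (h : ∀ y, B x y = 0) : x = 0 :=
  hB.eq_zero_of_nonneg hy₀ (by rw [hB.symm, h]) (by rw [h])

/-- Orthogonal isotropic vectors are parallel. -/
theorem exists_smul_eq {y₀ x y : V} (hy₀ : 0 < B y₀ y₀) (hx : B x x = 0) (hy : B y y = 0)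
    (hxy : B x y = 0) (hx0 : x ≠ 0) : ∃ c : ℝ, y = c • x := by
  have ha : B y₀ x ≠ 0 := fun h => hx0 (hB.eq_zero_of_nonneg hy₀ h hx.ge)
  refine ⟨B y₀ y / B y₀ x, ?_⟩
  rw [← sub_eq_zero]
  refine hB.eq_zero_of_nonneg hy₀ ?_ ?_
  · simp [ha]
  · simp [hx, hy, hxy, hB.symm y x]

theorem add_mem_formCone {y₀ y z : V} (hy₀ : 0 < B y₀ y₀) (hy : y ∈ closedFormCone B y₀)
    (hz : z ∈ formCone B y₀) : y + z ∈ formCone B y₀ := by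
  have := hB.nonneg_of_mem hy₀ hy hz
  refine ⟨?_, ?_⟩
  · simp only [map_add, LinearMap.add_apply, hB.symm y z]
    linarith [hy.1, hz.1]
  · simp only [map_add]
    linarith [hy.2, hz.2]

omit hB in
theorem smul_mem_formCone {y₀ y : V} (hy : y ∈ formCone B y₀) {c : ℝ} (hc : 0 < c) :
    c • y ∈ formCone B y₀ := by
  refine ⟨?_, ?_⟩
  · simpa using mul_pos hc (mul_pos hc hy.1)
  · simpa using mul_pos hc hy.2

theorem convex_formCone {y₀ : V} (hy₀ : 0 < B y₀ y₀) : Convex ℝ (formCone B y₀) := by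
  rw [convex_iff_forall_pos]
  intro x hx y hy a b ha hb _
  exact hB.add_mem_formCone hy₀ (formCone_subset _ (smul_mem_formCone hx ha))
    (smul_mem_formCone hy hb)

/-- Every vector is absorbed by the cone. -/
theorem exists_smul_add_mem {y₀ : V} (hy₀ : 0 < B y₀ y₀) (x : V) :
    ∃ c : ℝ, 0 < c ∧ c • y₀ + x ∈ formCone B y₀ := by
  set q := B y₀ y₀
  set a := B y₀ x
  -- This c satisfies c q ≥ 1 + 2|a| and c ≥ |B(x, x)| + 1, so the norm c(c q + 2a) + B(x, x) is at
  -- least 1.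
  have hc : 0 < (1 + 2 * |a|) / q + |B x x| + 1 := by positivity
  have h1 : 1 + 2 * |a| ≤ ((1 + 2 * |a|) / q + |B x x| + 1) * q := by
    rw [add_assoc, add_mul, div_mul_cancel₀ _ hy₀.ne']
    have : 0 ≤ (|B x x| + 1) * q := mul_nonneg (by positivity) hy₀.le
    linarith
  have h2 : |B x x| + 1 ≤ (1 + 2 * |a|) / q + |B x x| + 1 := by
    have : 0 ≤ (1 + 2 * |a|) / q := div_nonneg (by positivity) hy₀.le
    linarith
  have h3 := neg_abs_le a
  have h4 := neg_abs_le (B x x)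
  refine ⟨(1 + 2 * |a|) / q + |B x x| + 1, hc, ?_, ?_⟩
  · simp only [map_add, map_smul, LinearMap.add_apply, LinearMap.smul_apply, smul_eq_mul,
      hB.symm x y₀]
    generalize (1 + 2 * |a|) / q + |B x x| + 1 = c at *
    change 0 < c * (c * q + a) + (c * a + B x x)
    nlinarith
  · simp only [map_add, map_smul, smul_eq_mul]
    generalize (1 + 2 * |a|) / q + |B x x| + 1 = c at *
    change 0 < c * q + a
    linarith [abs_nonneg a]

section Isometry

variable {u : Module.End ℝ V} (hu : ∀ x y, B (u x) (u y) = B x y)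
include hu

omit hB in
-- Iterates the identity B((u - 1)a, u b) = -B(a, (u - 1)b).
theorem map_pow_sub_one (j : ℕ) (x y : V) :
    B (((u - 1) ^ j) x) ((u ^ j) y) = (-1) ^ j * B x (((u - 1) ^ j) y) := by
  induction j generalizing x y with
  | zero => simp
  | succ j ih =>
    have hc : Commute u ((u - 1) ^ j) := ((Commute.refl u).sub_right (Commute.one_right u)).pow_right j
    have h1 : ∀ a b, B ((u - 1) a) (u b) = - B a ((u - 1) b) := by
      intro a b
      simp only [LinearMap.sub_apply, Module.End.one_apply, map_sub, hu]
      ring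
    rw [pow_succ' (u - 1), pow_succ' u, Module.End.mul_apply, Module.End.mul_apply, h1,
      ← Module.End.mul_apply, ((Commute.refl u).sub_left (Commute.one_left u)).pow_right j |>.eq,
      Module.End.mul_apply, ih, ← Module.End.mul_apply (f := (u - 1) ^ j), ← pow_succ, ← pow_succ',
      pow_succ' (-1 : ℝ)]
    ring

/-- If (u - 1)^(j+4) = 0, the image of (u - 1)^(j+2) is totally isotropic, because 2(j + 2) ≥ j + 4.
Isotropic subspaces have dimension at most one, so u - 1 acts on this image by a nilpotent scalar,
that is, by zero; the exponent thus descends to 3. -/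
theorem sub_one_cube_eq_zero {y₀ : V} (hy₀ : 0 < B y₀ y₀) (hs : Function.Surjective u) {k : ℕ}
    (hk : (u - 1) ^ k = 0) : (u - 1) ^ 3 = 0 := by
  have step : ∀ j : ℕ, (u - 1) ^ (j + 4) = 0 → (u - 1) ^ (j + 3) = 0 := by
    intro j hj
    have hiso : ∀ x y, B (((u - 1) ^ (j + 2)) x) (((u - 1) ^ (j + 2)) y) = 0 := by
      intro x y
      -- Surjectivity rewrites the second argument as u^(j+2) y, the shape needed to move (u -
      -- 1)^(j+2) across the form.
      have hsj : Function.Surjective (u ^ (j + 2)) := by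
        rw [Module.End.coe_pow]; exact hs.iterate _
      obtain ⟨y, rfl⟩ := hsj y
      have hc : Commute (u - 1) u := (Commute.refl u).sub_left (Commute.one_left u)
      rw [← Module.End.mul_apply, (hc.pow_pow _ _).eq, Module.End.mul_apply, map_pow_sub_one hu,
        ← Module.End.mul_apply, ← pow_add, show j + 2 + (j + 2) = j + 4 + j by ring, pow_add _ (j + 4), hj]
      simp
    ext x
    set e := ((u - 1) ^ (j + 2)) x with he
    have hf : ((u - 1) ^ (j + 3)) x = (u - 1) e := by
      rw [he, ← Module.End.mul_apply, ← pow_succ']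
    have hf' : ((u - 1) ^ (j + 3)) x = ((u - 1) ^ (j + 2)) ((u - 1) x) := by
      rw [← Module.End.mul_apply, ← pow_succ]
    have hff : (u - 1) ((u - 1) e) = 0 := by
      rw [← hf, ← Module.End.mul_apply, ← pow_succ', hj, LinearMap.zero_apply]
    rw [LinearMap.zero_apply]
    by_cases he0 : e = 0
    · rw [hf, he0, map_zero]
    · obtain ⟨c, hc⟩ := hB.exists_smul_eq hy₀ (hiso x x) (hiso ((u - 1) x) ((u - 1) x))
        (hiso x ((u - 1) x)) he0
      rw [← hf', hf] at hc
      rw [hc, map_smul, hc] at hff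
      rw [hf, hc]
      rcases smul_eq_zero.1 hff with h | h
      · rw [h, zero_smul]
      · exact h
  have down : ∀ j : ℕ, (u - 1) ^ (j + 3) = 0 → (u - 1) ^ 3 = 0 := by
    intro j
    induction j with
    | zero => exact id
    | succ j ih => exact fun h => ih (step j h)
  exact down k (by rw [pow_add, hk, zero_mul])

/-- A unipotent isometry `u` with `(u - 1)² y = 0` for a vector `y` of positive norm is trivial. -/
theorem eq_one_of_sq_apply_eq_zero {k : ℕ} (hk : (u - 1) ^ k = 0) {y : V} (hy : 0 < B y y)
    (hy2 : (u - 1) ((u - 1) y) = 0) : u = 1 := by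
  set n := u - 1 with hn
  have hun : ∀ x, u x = x + n x := fun x => by simp [hn]
  -- Invariance of B(y, y) and of B(y, n y) makes n y isotropic and orthogonal to `y`, hence zero.
  have hny : n y = 0 := by
    have h1 : B (y + n y) (y + n y) = B y y := by rw [← hun, hu]
    have h2 : B (y + n y) (n y) = B y (n y) := by
      have := hu y (n y)
      rwa [hun, hun (n y), hy2, add_zero] at this
    simp only [map_add, LinearMap.add_apply, hB.symm (n y) y] at h1 h2
    exact hB.eq_zero_of_nonneg hy (by linarith) (by linarith)
  have horth : ∀ x, B y x = 0 → ∀ j : ℕ, B y ((n ^ j) x) = 0 := by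
    intro x hx j
    induction j with
    | zero => simpa using hx
    | succ j ih =>
      rw [pow_succ', Module.End.mul_apply]
      have h1 := hu y ((n ^ j) x)
      rw [hun, hny, add_zero, hun ((n ^ j) x), map_add] at h1
      linarith
  -- The same argument on the definite space orthogonal to `y`: there n² z = 0 already implies n z =
  -- 0, so nilpotency collapses to n = 0.
  have hz : ∀ z, B y z = 0 → n (n z) = 0 → n z = 0 := by
    intro z hz hz2
    have h1 : B (z + n z) (n z) = B z (n z) := by
      have := hu z (n z)
      rwa [hun, hun (n z), hz2, add_zero] at this
    simp only [map_add, LinearMap.add_apply] at h1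
    have h2 := horth z hz 1
    rw [pow_one] at h2
    exact hB.eq_zero_of_nonneg hy h2 (by linarith)
  have hzero : ∀ x, B y x = 0 → n x = 0 := by
    intro x hx
    have down : ∀ j : ℕ, (n ^ (j + 1)) x = 0 → n x = 0 := by
      intro j
      induction j with
      | zero => simp
      | succ j ih =>
        intro h
        refine ih ?_
        rw [pow_succ', Module.End.mul_apply]
        refine hz _ (horth x hx j) ?_
        rwa [← Module.End.mul_apply, ← Module.End.mul_apply, mul_assoc n n, ← pow_succ',
          ← pow_succ']
    exact down k (by rw [pow_succ', hk, mul_zero, LinearMap.zero_apply])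
  ext x
  have h := hzero (x - (B y x / B y y) • y) (by simp [hy.ne'])
  rw [map_sub, map_smul, hny, smul_zero, sub_zero] at h
  rw [hun, h, add_zero, Module.End.one_apply]

end Isometry

end IsHyperbolic
end Hyperbolic

/-! ### Kronecker's theorem and quasi-unipotence -/

section IntegerMatrix
open Polynomial Matrix Filter Topology

variable {n : Type*} [Fintype n] [DecidableEq n]

theorem norm_le_one_of_pow_le {x a C : ℝ} (ha : 0 < a)
    (h : ∀ k : ℕ, x ^ k * a ≤ C * (1 + (k : ℝ) ^ 2)) : x ≤ 1 := by
  by_contra! hx1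
  have h1 := tendsto_pow_const_div_const_pow_of_one_lt 2 hx1
  have h0 := tendsto_pow_const_div_const_pow_of_one_lt 0 hx1
  have h2 : Tendsto (fun k : ℕ => C * ((k : ℝ) ^ 0 / x ^ k + (k : ℝ) ^ 2 / x ^ k)) atTop (𝓝 0) := by
    simpa using (h0.add h1).const_mul C
  have h3 : a ≤ 0 := by
    refine ge_of_tendsto' h2 fun k => ?_
    have hk : 0 < x ^ k := by positivity
    rw [pow_zero, ← add_div, ← mul_div_assoc, le_div_iff₀ hk, mul_comm]
    exact h k
  linarith

/-- A non-zero coordinate of an eigenvector turns growth of the powers of `M` into growth of |μ|ᵏ,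
and a geometric sequence of ratio above 1 beats any quadratic. -/
theorem norm_le_one_of_isRoot_charpoly {M : Matrix n n ℤ}
    (hM : ∀ i j, ∃ C : ℝ, ∀ k : ℕ, |((M ^ k) i j : ℝ)| ≤ C * (1 + (k : ℝ) ^ 2)) {μ : ℂ}
    (hμ : (M.map (Int.castRingHom ℂ)).charpoly.IsRoot μ) : ‖μ‖ ≤ 1 := by
  choose C hC using hM
  set A := M.map (Int.castRingHom ℂ) with hA
  obtain ⟨v, hv0, hv⟩ := Matrix.exists_mulVec_eq_zero_iff.2
    (show (scalar n μ - A).det = 0 by rw [← Matrix.eval_charpoly]; exact hμ)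
  rw [Matrix.sub_mulVec, sub_eq_zero] at hv
  have hAv : A *ᵥ v = μ • v := by
    rw [← hv]
    ext i
    simp [Matrix.scalar_apply, Matrix.mulVec_diagonal]
  have hpow : ∀ k : ℕ, (A ^ k) *ᵥ v = μ ^ k • v := by
    intro k
    induction k with
    | zero => simp
    | succ k ih => rw [pow_succ, ← Matrix.mulVec_mulVec, hAv, Matrix.mulVec_smul, ih, smul_smul,
        pow_succ']
  obtain ⟨i, hi⟩ := Function.ne_iff.1 hv0
  refine norm_le_one_of_pow_le (norm_pos_iff.2 hi) (C := ∑ j, C i j * ‖v j‖)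
    fun k => ?_
  rw [← norm_pow, ← norm_mul]
  have h1 : μ ^ k * v i = ∑ j, ((M ^ k) i j : ℂ) * v j := by
    have := congrFun (hpow k) i
    rw [hA, ← Matrix.map_pow] at this
    simpa [Matrix.mulVec, dotProduct] using this.symm
  rw [h1, Finset.sum_mul]
  refine norm_sum_le_of_le _ fun j _ => ?_
  rw [norm_mul]
  have h2 : ‖((M ^ k) i j : ℂ)‖ = |((M ^ k) i j : ℝ)| := by
    rw [← Complex.ofReal_intCast, Complex.norm_real, Real.norm_eq_abs]
  rw [h2, mul_right_comm]
  exact mul_le_mul_of_nonneg_right (hC i j k) (norm_nonneg _)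

/-- If all complex roots of a monic integer polynomial lie in the closed unit disc, then the
non-zero ones are roots of unity (Kronecker). -/
theorem exists_pow_eq_one_of_norm_roots_le_one {p : ℤ[X]} (hp : p.Monic)
    (h : ∀ z ∈ p.aroots ℂ, ‖z‖ ≤ 1) {z : ℂ} (hz : z ∈ p.aroots ℂ) (hz0 : z ≠ 0) :
    ∃ k : ℕ, 0 < k ∧ z ^ k = 1 := by
  have hm : (p.map (Int.castRingHom ℂ)).mahlerMeasure = 1 := by
    rw [mahlerMeasure_eq_leadingCoeff_mul_prod_roots, (hp.map _).leadingCoeff, norm_one, one_mul]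
    apply Multiset.prod_eq_one
    intro x hx
    obtain ⟨y, hy, rfl⟩ := Multiset.mem_map.1 hx
    exact max_eq_left (h y hy)
  exact pow_eq_one_of_mahlerMeasure_eq_one hm hz0 hz

/-- An invertible integer matrix whose powers grow at most quadratically is quasi-unipotent. -/
theorem exists_pow_sub_one_isNilpotent {M : Matrix n n ℤ} (hdet : IsUnit M.det)
    (hM : ∀ i j, ∃ C : ℝ, ∀ k : ℕ, |((M ^ k) i j : ℝ)| ≤ C * (1 + (k : ℝ) ^ 2)) :
    ∃ l : ℕ, 0 < l ∧ IsNilpotent (M ^ l - 1) := by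
  set A := M.map (Int.castRingHom ℂ) with hA
  have hAp : A.charpoly = M.charpoly.map (Int.castRingHom ℂ) := Matrix.charpoly_map M _
  have hmon : A.charpoly.Monic := A.charpoly_monic
  have hroot : ∀ z ∈ A.charpoly.roots, ∃ k : ℕ, 0 < k ∧ z ^ k = 1 := by
    intro z hz
    have hz' : A.charpoly.IsRoot z := (mem_roots'.1 hz).2
    refine exists_pow_eq_one_of_norm_roots_le_one M.charpoly_monic (fun w hw => ?_) (z := z) ?_ ?_
    · refine norm_le_one_of_isRoot_charpoly hM ?_
      have := (mem_roots'.1 hw).2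
      rwa [← hA, hAp]
    · rw [hAp] at hz; exact hz
    · rintro rfl
      rw [IsRoot, Matrix.eval_charpoly, map_zero, zero_sub, Matrix.det_neg, mul_eq_zero] at hz'
      have : A.det = (M.det : ℂ) := by
        rw [hA, ← RingHom.mapMatrix_apply, ← RingHom.map_det]; rfl
      rw [this] at hz'
      rcases hz' with h | h
      · exact absurd h (pow_ne_zero _ (by norm_num))
      · exact hdet.ne_zero (by exact_mod_cast h)
  choose! e he0 he using hroot
  set l := A.charpoly.roots.toFinset.prod e with hl
  refine ⟨l, Finset.prod_pos fun z hz => he0 z (Multiset.mem_toFinset.1 hz), ?_⟩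
  have hle : ∀ z ∈ A.charpoly.roots, z ^ l = 1 := by
    intro z hz
    obtain ⟨c, hc⟩ := Finset.dvd_prod_of_mem e (Multiset.mem_toFinset.2 hz)
    rw [hl, hc, pow_mul, he z hz, one_pow]
  -- Every linear factor X - z divides X^l - 1; by Cayley–Hamilton, A^l - 1 is then nilpotent.
  have hdvd : A.charpoly ∣ (X ^ l - 1) ^ A.charpoly.roots.card := by
    have hs := (IsAlgClosed.splits A.charpoly).eq_prod_roots_of_monic hmon
    conv_lhs => rw [hs]
    have : ∀ s : Multiset ℂ, (∀ z ∈ s, z ^ l = 1) →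
        (s.map fun a => X - C a).prod ∣ (X ^ l - 1 : ℂ[X]) ^ s.card := by
      intro s
      induction s using Multiset.induction_on with
      | empty => simp
      | cons a s ih =>
        intro h
        rw [Multiset.map_cons, Multiset.prod_cons, Multiset.card_cons, pow_succ']
        refine mul_dvd_mul ?_ (ih fun z hz => h z (Multiset.mem_cons_of_mem hz))
        rw [dvd_iff_isRoot]
        simp [h a (Multiset.mem_cons_self a s)]
    exact this _ hle
  obtain ⟨q, hq⟩ := hdvd
  have hA0 : (A ^ l - 1) ^ A.charpoly.roots.card = 0 := by
    have := congrArg (aeval A) hq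
    simpa [Matrix.aeval_self_charpoly] using this
  refine ⟨A.charpoly.roots.card, ?_⟩
  have hinj : Function.Injective (Int.castRingHom ℂ).mapMatrix (α := Matrix n n ℤ) :=
    Matrix.map_injective Int.cast_injective
  apply hinj
  rw [map_pow, map_sub, map_pow, map_one, map_zero]
  exact hA0

end IntegerMatrix

/-! ### Real and complex extensions of the lattice -/

section Tensor
variable {K : Type*} [AddCommGroup K]

/-- The bilinear form on `K ⊗ ℝ`. -/
noncomputable def realBilin (Q : QuadraticForm ℤ K) : LinearMap.BilinForm ℝ (ℝ ⊗[ℤ] K) :=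
  LinearMap.BilinForm.baseChange ℝ (QuadraticMap.polarBilin Q)

theorem realForm_eq (Q : QuadraticForm ℤ K) (Y : ℝ ⊗[ℤ] K) :
    realForm Q Y = (1 / 2 : ℝ) * realBilin Q Y Y := by
  simp [realForm, realBilin, LinearMap.BilinMap.toQuadraticMap_apply]

theorem realForm_pos_iff (Q : QuadraticForm ℤ K) (Y : ℝ ⊗[ℤ] K) :
    0 < realForm Q Y ↔ 0 < realBilin Q Y Y := by
  rw [realForm_eq]; constructor <;> intro h <;> linarith

theorem realBilin_tmul (Q : QuadraticForm ℤ K) (a b : ℝ) (x y : K) :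
    realBilin Q (a ⊗ₜ x) (b ⊗ₜ y) = a * b * (QuadraticMap.polar Q x y : ℤ) := by
  simp [realBilin]
  ring

theorem realBilin_symm (Q : QuadraticForm ℤ K) (x y : ℝ ⊗[ℤ] K) :
    realBilin Q x y = realBilin Q y x := by
  induction x with
  | zero => simp
  | add a b ha hb => simp [ha, hb]
  | tmul a x =>
    induction y with
    | zero => simp
    | add a b ha hb => simp [ha, hb]
    | tmul b y => rw [realBilin_tmul, realBilin_tmul, QuadraticMap.polar_comm, mul_comm a]

theorem realBilin_scalarAct {Q : QuadraticForm ℤ K} {U : K ≃ₗ[ℤ] K} (hU : U ∈ orthogonalGroup Q)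
    (x y : ℝ ⊗[ℤ] K) :
    realBilin Q (scalarAct ℝ U x) (scalarAct ℝ U y) = realBilin Q x y := by
  have hU' : ∀ z, Q (U z) = Q z := hU
  induction x with
  | zero => simp
  | add a b ha hb => simp [ha, hb]
  | tmul a x =>
    induction y with
    | zero => simp
    | add a b ha hb => simp [ha, hb]
    | tmul b y =>
      have h1 : ∀ (c : ℝ) z, scalarAct ℝ U (c ⊗ₜ[ℤ] z) = c ⊗ₜ U z := fun c z => rfl
      rw [h1, h1, realBilin_tmul, realBilin_tmul]
      simp only [QuadraticMap.polar, ← map_add, hU']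

/-- The complex-linear extension to `K ⊗ ℂ` of a real functional on `K ⊗ ℝ`. -/
noncomputable def complexify (φ : ℝ ⊗[ℤ] K →ₗ[ℝ] ℝ) : ℂ ⊗[ℤ] K →ₗ[ℂ] ℂ :=
  LinearMap.liftBaseChange ℂ ((Complex.ofRealHom : ℝ →+ ℂ).toIntLinearMap ∘ₗ
    (φ.restrictScalars ℤ) ∘ₗ TensorProduct.mk ℤ ℝ K 1)

theorem complexify_tmul (φ : ℝ ⊗[ℤ] K →ₗ[ℝ] ℝ) (a : ℂ) (x : K) :
    complexify φ (a ⊗ₜ x) = a * (φ (1 ⊗ₜ x) : ℝ) := by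
  rw [complexify, LinearMap.liftBaseChange_tmul]; rfl

theorem map_tmul_eq (φ : ℝ ⊗[ℤ] K →ₗ[ℝ] ℝ) (a : ℝ) (x : K) : φ (a ⊗ₜ x) = a * φ (1 ⊗ₜ x) := by
  rw [← smul_eq_mul, ← map_smul, TensorProduct.smul_tmul', smul_eq_mul, mul_one]

theorem complexify_im (φ : ℝ ⊗[ℤ] K →ₗ[ℝ] ℝ) (Z : ℂ ⊗[ℤ] K) :
    (complexify φ Z).im = φ (imPart Z) := by
  induction Z with
  | zero => simp
  | add a b ha hb => simp [ha, hb]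
  | tmul a x => rw [complexify_tmul, imPart_tmul, map_tmul_eq φ a.im]; simp

theorem complexify_realToComplex (φ : ℝ ⊗[ℤ] K →ₗ[ℝ] ℝ) (v : ℝ ⊗[ℤ] K) :
    complexify φ (realToComplex v) = (φ v : ℝ) := by
  induction v with
  | zero => simp
  | add a b ha hb => simp [ha, hb]
  | tmul a x => rw [realToComplex_tmul, complexify_tmul, map_tmul_eq φ a]; simp

theorem complexify_one_tmul (φ : ℝ ⊗[ℤ] K →ₗ[ℝ] ℝ) (x : K) :
    complexify φ (1 ⊗ₜ x) = (φ (1 ⊗ₜ x) : ℝ) := by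
  rw [complexify_tmul, one_mul]

theorem imPart_scalarAct (U : K ≃ₗ[ℤ] K) (Z : ℂ ⊗[ℤ] K) :
    imPart (scalarAct ℂ U Z) = scalarAct ℝ U (imPart Z) := by
  induction Z with
  | zero => simp
  | add a b ha hb => simp [ha, hb]
  | tmul a x => simp [scalarAct, imPart_tmul]

theorem imPart_one_tmul (x : K) : imPart (1 ⊗ₜ[ℤ] x) = 0 := by
  rw [imPart_tmul]; simp

theorem scalarAct_pow (R : Type*) [CommRing R] (U : K ≃ₗ[ℤ] K) (n : ℕ) :
    scalarAct R (U ^ n) = scalarAct R U ^ n := by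
  induction n with
  | zero => ext x; simp [scalarAct_one]
  | succ n ih => 
    refine LinearMap.ext fun x => ?_
    rw [pow_succ, pow_succ, ← ih, Module.End.mul_apply, scalarAct_mul]

variable [Module.Free ℤ K] [Module.Finite ℤ K]

/-- If `z` were orthogonal to `y` with non-negative norm, the form would be non-negative on the
plane they span, leaving at most p - 2 negative directions. -/
theorem IsLorentzian.isHyperbolic {Q : QuadraticForm ℤ K} (hQ : IsLorentzian Q) :
    IsHyperbolic (realBilin Q) := by
  refine ⟨realBilin_symm Q, fun y hy z hyz hz => ?_⟩
  by_contra! hzz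
  have hli : LinearIndependent ℝ ![y, z] := by
    rw [LinearIndependent.pair_iff]
    intro a b hab
    have h1 := congrArg (realBilin Q y) hab
    simp [hyz] at h1
    have ha : a = 0 := h1.resolve_right hy.ne'
    rw [ha, zero_smul, zero_add] at hab
    exact ⟨ha, (smul_eq_zero.1 hab).resolve_right hz⟩
  have h := QuadraticForm.sigPos_add_finrank_le_of_nonpos (Q := -realForm Q)
    (V := Submodule.span ℝ (Set.range ![y, z])) (by
      intro x hx
      rw [Matrix.range_cons, Matrix.range_cons, Matrix.range_empty, Set.union_empty,
        Set.singleton_union] at hx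
      obtain ⟨a, b, rfl⟩ := Submodule.mem_span_pair.1 hx
      rw [neg_apply, neg_nonpos, realForm_eq]
      simp [hyz, realBilin_symm Q z y]
      nlinarith [mul_nonneg (mul_self_nonneg a) hy.le, mul_nonneg (mul_self_nonneg b) hzz])
  rw [finrank_span_eq_card hli, Fintype.card_fin, sigPos_neg, Module.finrank_baseChange] at h
  have := hQ.2
  omega

omit [Module.Free ℤ K] [Module.Finite ℤ K] in
theorem continuous_functional (φ : ℝ ⊗[ℤ] K →ₗ[ℝ] ℝ) : Continuous φ :=
  IsModuleTopology.continuous_of_linearMap φ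

instance : ContinuousSMul ℝ (ℝ ⊗[ℤ] K) := IsModuleTopology.toContinuousSMul ℝ _
instance : IsTopologicalAddGroup (ℝ ⊗[ℤ] K) := IsModuleTopology.topologicalAddGroup ℝ _

omit [Module.Free ℤ K] in
theorem continuous_realBilin_self (Q : QuadraticForm ℤ K) :
    Continuous fun Y => realBilin Q Y Y := by
  have h : Continuous fun p : (ℝ ⊗[ℤ] K) × (ℝ ⊗[ℤ] K) => realBilin Q p.1 p.2 :=
    IsModuleTopology.continuous_bilinear_of_finite_left (R := ℝ) (realBilin Q)
  have hd : Continuous fun Y : ℝ ⊗[ℤ] K => (Y, Y) := by fun_prop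
  have := h.comp hd
  simpa only [Function.comp_def] using this

omit [Module.Free ℤ K] in
theorem isOpen_formCone (Q : QuadraticForm ℤ K) (y₀ : ℝ ⊗[ℤ] K) :
    IsOpen (formCone (realBilin Q) y₀) :=
  (isOpen_lt continuous_const (continuous_realBilin_self Q)).inter
    (isOpen_lt continuous_const (continuous_functional _))

omit [Module.Free ℤ K] in
-- A point x of the closed cone is the limit of x + ε y₀ as ε decreases to 0, and these points lie
-- in the open cone.
theorem closure_formCone {Q : QuadraticForm ℤ K} (hB : IsHyperbolic (realBilin Q)) {y₀ : ℝ ⊗[ℤ] K}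
    (hy₀ : 0 < realBilin Q y₀ y₀) :
    closure (formCone (realBilin Q) y₀) = closedFormCone (realBilin Q) y₀ := by
  apply Set.Subset.antisymm
  · refine closure_minimal (IsHyperbolic.formCone_subset y₀) ?_
    exact (isClosed_le continuous_const (continuous_realBilin_self Q)).inter
      (isClosed_le continuous_const (continuous_functional _))
  · intro x hx
    have hlim : Filter.Tendsto (fun ε : ℝ => x + ε • y₀) (nhdsWithin 0 (Set.Ioi 0)) (nhds x) := by
      have : Filter.Tendsto (fun ε : ℝ => x + ε • y₀) (nhds 0) (nhds (x + (0 : ℝ) • y₀)) :=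
        Continuous.tendsto (by fun_prop) 0
      rw [zero_smul, add_zero] at this
      exact this.mono_left nhdsWithin_le_nhds
    refine mem_closure_of_tendsto hlim ?_
    filter_upwards [self_mem_nhdsWithin] with ε hε
    exact hB.add_mem_formCone hy₀ hx (IsHyperbolic.smul_mem_formCone ⟨hy₀, hy₀⟩ hε)

omit [Module.Free ℤ K] [Module.Finite ℤ K] in
-- The functional B(y₀, ·) has no zero on vectors of positive norm, so it keeps its sign on the
-- component; conversely the half-cone it cuts out is convex, hence connected.
theorem IsPositiveCone.exists_eq_formCone {Q : QuadraticForm ℤ K}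
    (hB : IsHyperbolic (realBilin Q)) {C : Set (ℝ ⊗[ℤ] K)} (hC : IsPositiveCone Q C) :
    ∃ y₀, 0 < realBilin Q y₀ y₀ ∧ C = formCone (realBilin Q) y₀ := by
  obtain ⟨y₀, hy, rfl⟩ := hC
  have hy₀ : 0 < realBilin Q y₀ y₀ := (realForm_pos_iff Q y₀).1 hy
  refine ⟨y₀, hy₀, Set.Subset.antisymm ?_ ?_⟩
  · intro x hx
    have hpos : ∀ z ∈ connectedComponentIn (positiveVectors Q) y₀, 0 < realBilin Q z z :=
      fun z hz => (realForm_pos_iff Q z).1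
        (show z ∈ positiveVectors Q from connectedComponentIn_subset _ _ hz)
    refine ⟨hpos x hx, ?_⟩
    by_contra! hneg
    obtain ⟨z, hz, hz0⟩ := isPreconnected_connectedComponentIn.intermediate_value hx
      (mem_connectedComponentIn hy) (continuous_functional (realBilin Q y₀)).continuousOn
      (Set.mem_Icc.2 ⟨hneg, hy₀.le⟩)
    exact absurd (hB.nonpos hy₀ hz0) (not_le.2 (hpos z hz))
  · refine (hB.convex_formCone hy₀).isPreconnected.subset_connectedComponentIn ⟨hy₀, hy₀⟩ ?_
    exact fun z hz => (realForm_pos_iff Q z).2 hz.1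

omit [Module.Free ℤ K] [Module.Finite ℤ K] in
theorem coord_one_tmul {ι : Type*} (b : Module.Basis ι ℤ K) (i : ι) (x : K) :
    (b.baseChange ℝ).coord i (1 ⊗ₜ x) = (b.repr x i : ℝ) := by
  simp [Module.Basis.baseChange_repr_tmul]

omit [Module.Finite ℤ K] in
theorem one_tmul_injective : Function.Injective fun x : K => (1 : ℝ) ⊗ₜ[ℤ] x := by
  intro x y hxy
  refine (Module.Free.chooseBasis ℤ K).ext_elem fun i => ?_
  have := congrArg ((Module.Free.chooseBasis ℤ K).baseChange ℝ |>.coord i) hxy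
  simp only [coord_one_tmul] at this
  exact_mod_cast this

omit [Module.Free ℤ K] in
/-- Every functional on `K ⊗ ℝ` is represented by a vector. -/
theorem exists_realBilin_eq {Q : QuadraticForm ℤ K} (hB : IsHyperbolic (realBilin Q))
    {y₀ : ℝ ⊗[ℤ] K} (hy₀ : 0 < realBilin Q y₀ y₀) (φ : ℝ ⊗[ℤ] K →ₗ[ℝ] ℝ) :
    ∃ w, realBilin Q w = φ := by
  have hinj : Function.Injective (realBilin Q) := by
    rw [injective_iff_map_eq_zero]
    intro x hx
    exact hB.eq_zero_of_forall hy₀ fun y => by rw [hx, LinearMap.zero_apply]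
  exact (LinearMap.injective_iff_surjective_of_finrank_eq_finrank
    (Subspace.dual_finrank_eq (K := ℝ) (V := ℝ ⊗[ℤ] K)).symm).1 hinj φ

end Tensor

/-! ### Growth of orbits in the cone -/

section Growth
open Asymptotics Filter Topology

variable {V : Type*} [AddCommGroup V] [Module ℝ V] {B : LinearMap.BilinForm ℝ V}

namespace IsHyperbolic

theorem formCone_eq (hB : IsHyperbolic B) {y₀ y₁ : V} (hy₀ : 0 < B y₀ y₀)
    (hy₁ : y₁ ∈ formCone B y₀) : formCone B y₁ = formCone B y₀ := by
  ext x
  constructor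
  · intro hx
    have h0 : y₀ ∈ formCone B y₁ := ⟨hy₀, hB.symm y₀ y₁ ▸ hy₁.2⟩
    exact ⟨hx.1, hB.pos_of_mem_formCone hy₁.1 hx h0⟩
  · intro hx
    exact ⟨hx.1, hB.pos_of_mem_formCone hy₀ hx hy₁⟩

/-- An isometry that maps one vector of the cone into the cone preserves the cone. -/
theorem map_mem_formCone (hB : IsHyperbolic B) {u : Module.End ℝ V}
    (hu : ∀ x y, B (u x) (u y) = B x y) {y₁ : V} (hy₁ : 0 < B y₁ y₁)
    (huy : u y₁ ∈ formCone B y₁) {x : V} (hx : x ∈ formCone B y₁) : u x ∈ formCone B y₁ := by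
  rw [← hB.formCone_eq hy₁ huy]
  exact ⟨by rw [hu]; exact hx.1, by rw [hu]; exact hx.2⟩

/-- If the orbit of one vector of the cone grows at most quadratically, then so do all orbits. -/
theorem isBigO_apply_pow (hB : IsHyperbolic B) {u : Module.End ℝ V}
    (hu : ∀ x y, B (u x) (u y) = B x y) {y₁ : V} (hy₁ : 0 < B y₁ y₁)
    (huy : u y₁ ∈ formCone B y₁)
    (hgrow : (fun n : ℕ => B y₁ ((u ^ n) y₁)) =O[⊤] fun n : ℕ => 1 + (n : ℝ) ^ 2) (w x : V) :
    (fun n : ℕ => B w ((u ^ n) x)) =O[⊤] fun n : ℕ => 1 + (n : ℝ) ^ 2 := by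
  have hmap : ∀ (n : ℕ), ∀ x ∈ formCone B y₁, (u ^ n) x ∈ formCone B y₁ := by
    intro n
    induction n with
    | zero => simp
    | succ n ih =>
      intro x hx
      rw [pow_succ, Module.End.mul_apply]
      exact ih _ (hB.map_mem_formCone hu hy₁ huy hx)
  have hy₁' : y₁ ∈ formCone B y₁ := ⟨hy₁, hy₁⟩
  have hcone : ∀ w ∈ formCone B y₁, ∀ x ∈ formCone B y₁,
      (fun n : ℕ => B w ((u ^ n) x)) =O[⊤] fun n : ℕ => 1 + (n : ℝ) ^ 2 := by
    intro w hw x hx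
    -- Since c y₁ - w and d y₁ - x lie in the cone, B(w, uⁿx) ≤ c B(y₁, uⁿx) ≤ c d B(y₁, uⁿy₁).
    obtain ⟨c, hc, hcw⟩ := hB.exists_smul_add_mem hy₁ (-w)
    obtain ⟨d, hd, hdx⟩ := hB.exists_smul_add_mem hy₁ (-x)
    refine IsBigO.trans ?_ (hgrow.const_mul_left (c * d))
    refine isBigO_of_le _ fun n => ?_
    have h1 := hB.pos_of_mem_formCone hy₁ (hmap n x hx) hw
    have h2 := hB.pos_of_mem_formCone hy₁ (hmap n x hx) hcw
    have h3 := hB.pos_of_mem_formCone hy₁ (hmap n _ hdx) hy₁'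
    have h4 := hB.pos_of_mem_formCone hy₁ (hmap n _ hy₁') hy₁'
    simp only [map_add, map_neg, map_smul, LinearMap.add_apply, LinearMap.neg_apply,
      LinearMap.smul_apply, smul_eq_mul] at h2 h3
    rw [Real.norm_of_nonneg h1.le, Real.norm_of_nonneg (by positivity)]
    nlinarith
  -- Every vector is a difference of cone vectors, so bilinearity gives the general case.
  have hsub : ∀ x, ∃ c : ℝ, ∃ z ∈ formCone B y₁, x = z - c • y₁ := by
    intro x
    obtain ⟨c, -, hc⟩ := hB.exists_smul_add_mem hy₁ x
    exact ⟨c, _, hc, by abel⟩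
  obtain ⟨c, z, hz, rfl⟩ := hsub w
  obtain ⟨d, z', hz', rfl⟩ := hsub x
  have h := ((hcone z hz z' hz').sub ((hcone z hz y₁ hy₁').const_mul_left d)).sub
    (((hcone y₁ hy₁' z' hz').sub ((hcone y₁ hy₁' y₁ hy₁').const_mul_left d)).const_mul_left c)
  refine h.congr_left fun n => ?_
  simp only [map_sub, map_smul, LinearMap.sub_apply, LinearMap.smul_apply, smul_eq_mul]
  ring

end IsHyperbolic

/-- Divide by n² and let n tend to infinity. -/
theorem nonneg_of_forall_quadratic {a b c : ℝ}
    (h : ∀ n : ℕ, 0 ≤ a + n * b + (n : ℝ) ^ 2 * c) : 0 ≤ c := by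
  have h1 : Tendsto (fun n : ℕ => ((n : ℝ)⁻¹) ^ 2 * a + (n : ℝ)⁻¹ * b + c) atTop
      (𝓝 (0 ^ 2 * a + 0 * b + c)) :=
    (((tendsto_inv_atTop_nhds_zero_nat (𝕜 := ℝ)).pow 2).mul_const a |>.add
      ((tendsto_inv_atTop_nhds_zero_nat (𝕜 := ℝ)).mul_const b)).add_const c
  have h2 := ge_of_tendsto h1 (b := 0) (by
    filter_upwards [eventually_gt_atTop 0] with n hn
    have hn' : (0 : ℝ) < n := by exact_mod_cast hn
    have := h n
    have e : ((n : ℝ)⁻¹) ^ 2 * a + (n : ℝ)⁻¹ * b + c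
        = (a + n * b + (n : ℝ) ^ 2 * c) / (n : ℝ) ^ 2 := by field_simp
    rw [e]; positivity)
  simpa using h2

theorem pow_apply_of_cube_eq_zero {u : Module.End ℝ V} (h : (u - 1) ^ 3 = 0) (n : ℕ) (x : V) :
    (u ^ n) x = x + (n : ℝ) • (u - 1) x +
      ((n : ℝ) * (n - 1) / 2) • (u - 1) ((u - 1) x) := by
  set N := u - 1 with hN
  have hu : ∀ y, u y = y + N y := fun y => by simp [hN]
  have h3 : ∀ y, N (N (N y)) = 0 := fun y => by
    have := LinearMap.congr_fun h y
    rwa [pow_succ, pow_two] at this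
  induction n with
  | zero => simp
  | succ n ih =>
    rw [pow_succ', Module.End.mul_apply, ih, hu]
    simp only [map_add, map_smul, h3, smul_zero, add_zero]
    push_cast
    module

end Growth

/-! ### Finite order of the automorphisms -/

section FiniteOrder
open Asymptotics Filter Topology Complex

variable {K : Type*} [AddCommGroup K] [Module.Free ℤ K] [Module.Finite ℤ K]

/-- Coordinate functionals are pairings with vectors, so the growth of one orbit bounds every entry
of the integer matrices of Uⁿ. -/
theorem exists_isNilpotent_scalarAct {Q : QuadraticForm ℤ K} (hB : IsHyperbolic (realBilin Q))
    {U : K ≃ₗ[ℤ] K} (hU : U ∈ orthogonalGroup Q) {y₁ : ℝ ⊗[ℤ] K} (hy₁ : 0 < realBilin Q y₁ y₁)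
    (huy : scalarAct ℝ U y₁ ∈ formCone (realBilin Q) y₁)
    (hgrow : (fun n : ℕ => realBilin Q y₁ ((scalarAct ℝ U ^ n) y₁))
      =O[⊤] fun n : ℕ => 1 + (n : ℝ) ^ 2) :
    ∃ l : ℕ, 0 < l ∧ IsNilpotent (scalarAct ℝ U ^ l - 1) := by
  classical
  set b := Module.Free.chooseBasis ℤ K
  set M := LinearMap.toMatrix b b (U : K →ₗ[ℤ] K) with hM
  obtain ⟨l, hl, k, hk⟩ := exists_pow_sub_one_isNilpotent (M := M)
    (LinearEquiv.isUnit_det U b b) (fun i j => by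
      obtain ⟨w, hw⟩ := exists_realBilin_eq hB hy₁ ((b.baseChange ℝ).coord i)
      obtain ⟨C, hC⟩ := isBigO_top.1
        (hB.isBigO_apply_pow (realBilin_scalarAct hU) hy₁ huy hgrow w (1 ⊗ₜ b j))
      refine ⟨C, fun n => ?_⟩
      have := hC n
      rw [Real.norm_eq_abs, Real.norm_of_nonneg (by positivity)] at this
      convert this using 2
      rw [hw, ← scalarAct_pow, hM, LinearMap.toMatrix_pow, LinearMap.toMatrix_apply]
      have hpow : ((U : Module.End ℤ K) ^ n) (b j) = (U ^ n) (b j) := LinearMap.congr_fun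
        (map_pow (LinearEquiv.automorphismGroup.toLinearMapMonoidHom (R := ℤ) (M := K)) U n).symm _
      simp [scalarAct, hpow])
  refine ⟨l, hl, k, ?_⟩
  have h1 : ((U : Module.End ℤ K) ^ l - 1) ^ k = 0 := by
    apply (LinearMap.toMatrixAlgEquiv b).injective
    rw [map_zero, map_pow, map_sub, map_pow, map_one]
    exact hk
  have h2 := congrArg (Module.End.baseChangeHom ℤ ℝ K) h1
  rwa [map_zero, map_pow, map_sub, map_pow, map_one] at h2

/-- Harnack is used twice: at `I` to make a power of `U` unipotent, and high on the imaginary axis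
to exclude a non-trivial unipotent power. -/
theorem exists_pow_eq_one {Q : QuadraticForm ℤ K} (hB : IsHyperbolic (realBilin Q))
    {y₀ : ℝ ⊗[ℤ] K} (hy₀ : 0 < realBilin Q y₀ y₀) {ψ : ℂ → ℂ ⊗[ℤ] K}
    (hψ : ∀ φ : ℝ ⊗[ℤ] K →ₗ[ℝ] ℝ,
      DifferentiableOn ℂ (fun z => complexify φ (ψ z)) {z | 0 < z.im})
    (hmaps : ∀ z : ℂ, 0 < z.im → imPart (ψ z) ∈ formCone (realBilin Q) y₀)
    {U : K ≃ₗ[ℤ] K} (hU : U ∈ orthogonalGroup Q) (T : K)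
    (hT : ∀ z : ℂ, 0 < z.im → ψ (z + 1) = scalarAct ℂ U (ψ z) + 1 ⊗ₜ T) :
    ∃ l : ℕ, 0 < l ∧ U ^ l = 1 := by
  set u := scalarAct ℝ U with hu
  set B := realBilin Q with hBdef
  have hy₁C := hmaps I (by simp)
  set y₁ := imPart (ψ I) with hy₁def
  have hy₁ : 0 < B y₁ y₁ := hy₁C.1
  have hiso : ∀ x y, B (u x) (u y) = B x y := realBilin_scalarAct hU
  replace hmaps : ∀ z : ℂ, 0 < z.im → imPart (ψ z) ∈ formCone B y₁ := by
    rwa [hB.formCone_eq hy₀ hy₁C]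
  have hy₁' : y₁ ∈ formCone B y₁ := ⟨hy₁, hy₁⟩
  have him : ∀ n : ℕ, ∀ z : ℂ, 0 < z.im → imPart (ψ (z + n)) = (u ^ n) (imPart (ψ z)) := by
    intro n
    induction n with
    | zero => simp
    | succ n ih =>
      intro z hz
      rw [Nat.cast_succ, ← add_assoc, hT _ (by simpa using hz), map_add, imPart_one_tmul, add_zero,
        imPart_scalarAct, ih z hz, pow_succ', Module.End.mul_apply]
  have hharnack : ∀ z w : ℂ, 0 < z.im → 0 < w.im → B y₁ (imPart (ψ z)) ≤
      (2 + normSq (z - w) / (z.im * w.im)) * B y₁ (imPart (ψ w)) := by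
    intro z w hz hw
    have := im_le_mul_im_of_im_pos (hψ (B y₁)) (fun z hz => by
      rw [complexify_im]; exact (hmaps z hz).2) hz hw
    simpa only [complexify_im] using this
  have hshift : ∀ (n : ℕ) (z : ℂ), 0 < z.im → B y₁ ((u ^ n) (imPart (ψ z))) ≤
      (2 + (n : ℝ) ^ 2 / z.im ^ 2) * B y₁ (imPart (ψ z)) := by
    intro n z hz
    have := hharnack (z + n) z (by simpa using hz) hz
    rw [him n z hz, add_sub_cancel_left, normSq_natCast] at this
    simpa [sq] using this
  have huy : u y₁ ∈ formCone B y₁ := by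
    have := hmaps (I + (1 : ℕ)) (by simp)
    rwa [him 1 I (by simp), pow_one] at this
  have hmapn : ∀ (n : ℕ) (z : ℂ), 0 < z.im → (u ^ n) (imPart (ψ z)) ∈ formCone B y₁ := by
    intro n z hz
    rw [← him n z hz]
    exact hmaps _ (by simpa using hz)
  have hgrow : (fun n : ℕ => B y₁ ((u ^ n) y₁)) =O[⊤] fun n : ℕ => 1 + (n : ℝ) ^ 2 := by
    refine isBigO_top.2 ⟨2 * B y₁ y₁, fun n => ?_⟩
    have h1 := hshift n I (by simp)
    simp only [I_im, one_pow, div_one] at h1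
    have h2 := (hmapn n I (by simp)).2
    rw [Real.norm_of_nonneg h2.le, Real.norm_of_nonneg (by positivity)]
    nlinarith [mul_nonneg (sq_nonneg (n : ℝ)) hy₁.le]
  obtain ⟨l, hl, k, hk⟩ := exists_isNilpotent_scalarAct hB hU hy₁ huy hgrow
  have hl' : (0 : ℝ) < l := by exact_mod_cast hl
  refine ⟨l, hl, ?_⟩
  set v := u ^ l with hv
  have hviso : ∀ x y, B (v x) (v y) = B x y := by
    rw [hv, hu, ← scalarAct_pow]
    exact realBilin_scalarAct (pow_mem hU l)
  have hsurj : Function.Surjective v := by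
    intro x
    refine ⟨scalarAct ℝ (U ^ l)⁻¹ x, ?_⟩
    rw [hv, hu, ← scalarAct_pow, ← scalarAct_mul, mul_inv_cancel, scalarAct_one]
  have hcube := hB.sub_one_cube_eq_zero hviso hy₁ hsurj hk
  set N := v - 1 with hN
  have hvn : ∀ (n : ℕ) x, (v ^ n) x = x + (n : ℝ) • N x + ((n : ℝ) * (n - 1) / 2) • N (N x) :=
    pow_apply_of_cube_eq_zero hcube
  have hquad : ∀ (w : ℝ ⊗[ℤ] K) (n : ℕ) x, B w ((u ^ (l * n)) x) =
      B w x + n * (B w (N x) - B w (N (N x)) / 2) + (n : ℝ) ^ 2 * (B w (N (N x)) / 2) := by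
    intro w n x
    rw [pow_mul, ← hv, hvn]
    simp only [map_add, map_smul, smul_eq_mul]
    ring
  -- For each w in the cone, B(w, vⁿY) is positive and quadratic in n with leading coefficient B(w,
  -- N²Y) / 2; self-duality concludes.
  have hNN : ∀ z : ℂ, 0 < z.im → N (N (imPart (ψ z))) ∈ closedFormCone B y₁ := by
    intro z hz
    refine hB.mem_closedFormCone hy₁ fun w hw => ?_
    have := nonneg_of_forall_quadratic (a := B w (imPart (ψ z))) fun n => by
      rw [← hquad w n]
      exact (hB.pos_of_mem_formCone hy₁ (hmapn _ z hz) hw).le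
    linarith
  -- Compare the coefficients of n² in the Harnack bound for translation by l n.
  have hbound : ∀ z : ℂ, 0 < z.im → B y₁ (N (N (imPart (ψ z)))) ≤
      2 * (l : ℝ) ^ 2 / z.im ^ 2 * B y₁ (imPart (ψ z)) := by
    intro z hz
    have := nonneg_of_forall_quadratic (a := B y₁ (imPart (ψ z)))
      (b := -(B y₁ (N (imPart (ψ z))) - B y₁ (N (N (imPart (ψ z)))) / 2))
      (c := (l : ℝ) ^ 2 / z.im ^ 2 * B y₁ (imPart (ψ z)) - B y₁ (N (N (imPart (ψ z)))) / 2)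
      fun n => by
        have h := hshift (l * n) z hz
        rw [hquad] at h
        push_cast at h
        have e : ((l : ℝ) * n) ^ 2 / z.im ^ 2 = (n : ℝ) ^ 2 * ((l : ℝ) ^ 2 / z.im ^ 2) := by ring
        rw [e] at h
        nlinarith
    have e : 2 * (l : ℝ) ^ 2 / z.im ^ 2 = 2 * ((l : ℝ) ^ 2 / z.im ^ 2) := by ring
    rw [e]
    linarith
  -- Translation by `l` replaces Y by Y + N Y, so N³ = 0 makes the imaginary part periodic.
  obtain ⟨z, hz, hz0⟩ := exists_im_eq_zero_of_periodic
    (F := fun z => complexify (B y₁ ∘ₗ N ∘ₗ N) (ψ z)) (hψ _) (l := l)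
    (fun z hz => by rw [complexify_im]; exact (hNN z hz).2) hl'
    (fun z hz => by
      simp only [complexify_im, LinearMap.comp_apply]
      have h3 : ∀ y, N (N (N y)) = 0 := fun y => by
        have := LinearMap.congr_fun hcube y
        rwa [pow_succ, pow_two] at this
      have : imPart (ψ (z + (l : ℝ))) = imPart (ψ z) + N (imPart (ψ z)) := by
        rw [ofReal_natCast, him l z hz, hN, ← hv]
        simp
      rw [this]
      simp [h3])
    (C := 4 * (l : ℝ) ^ 2 * B y₁ y₁)
    (fun y hy => by
      have hy0 : 0 < y := by linarith
      have hyI : 0 < ((y : ℂ) * I).im := by simpa using hy0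
      simp only [complexify_im, LinearMap.comp_apply]
      refine (hbound _ hyI).trans ?_
      have h1 := hharnack (y * I) I hyI (by simp)
      have h2 : normSq (y * I - I) = (y - 1) ^ 2 := by
        simp [normSq_apply]; ring
      have h3 : ((y : ℂ) * I).im = y := by simp
      rw [h2, h3, I_im, mul_one, ← hy₁def] at h1
      rw [h3]
      -- The Harnack factor between iy and i is y + 1/y, so B(y₁, Y(iy)) grows at most linearly;
      -- dividing by y² leaves the decay 1 / y.
      have h4 : (2 + (y - 1) ^ 2 / y) ≤ 2 * y := by
        have : 2 + (y - 1) ^ 2 / y = y + 1 / y := by field_simp; ring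
        rw [this]
        have : 1 / y ≤ 1 := by rw [div_le_one hy0]; exact hy
        linarith
      have h5 : B y₁ (imPart (ψ (y * I))) ≤ 2 * y * B y₁ y₁ :=
        h1.trans (mul_le_mul_of_nonneg_right h4 hy₁.le)
      calc 2 * (l : ℝ) ^ 2 / y ^ 2 * B y₁ (imPart (ψ (y * I)))
          ≤ 2 * (l : ℝ) ^ 2 / y ^ 2 * (2 * y * B y₁ y₁) :=
            mul_le_mul_of_nonneg_left h5 (by positivity)
        _ = _ := by field_simp; ring)
  rw [complexify_im] at hz0
  have hzero : N (N (imPart (ψ z))) = 0 := by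
    by_contra hne
    exact (hB.pos_of_mem hy₁ (hNN z hz) hne hy₁').ne' hz0
  have hv1 : v = 1 := hB.eq_one_of_sq_apply_eq_zero hviso hk (hmaps z hz).1 hzero
  rw [hv, hu, ← scalarAct_pow] at hv1
  ext x
  exact one_tmul_injective (LinearMap.congr_fun hv1 (1 ⊗ₜ x))

end FiniteOrder

/-! ### Riemann extension across a hyperplane -/

section Removable
open Complex Metric Set Filter Topology MeasureTheory

variable {E : Type*} [NormedAddCommGroup E] [NormedSpace ℂ E] [FiniteDimensional ℂ E]

/-- Local form of Riemann's extension theorem across a hyperplane. -/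
theorem exists_differentiableAt_extension_nhds {f : E → ℂ} {Ω : Set E} (hΩ : IsOpen Ω)
    {L : E →L[ℂ] ℂ} {v : E} (hv : L v = 1) {M : ℝ}
    (hf : DifferentiableOn ℂ f (Ω ∩ {x | L x ≠ 0})) (hM : ∀ x ∈ Ω, L x ≠ 0 → ‖f x‖ ≤ M)
    {x₀ : E} (hx₀ : x₀ ∈ Ω) (hL : L x₀ = 0) :
    ∃ G : E → ℂ, ∃ δ > 0, ball x₀ δ ⊆ Ω ∧ (∀ x ∈ ball x₀ δ, DifferentiableAt ℂ G x) ∧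
      ∀ x ∈ ball x₀ δ, L x ≠ 0 → G x = f x := by
  have hopen : IsOpen (Ω ∩ {x | L x ≠ 0}) :=
    hΩ.inter (isOpen_ne_fun L.continuous continuous_const)
  obtain ⟨R, hR, hball⟩ := Metric.isOpen_iff.1 hΩ x₀ hx₀
  set r : ℝ := R / (2 * (‖v‖ + 1)) with hr
  have hr0 : 0 < r := by positivity
  have hrv : r * ‖v‖ < R / 2 := by
    have : r * (‖v‖ + 1) = R / 2 := by rw [hr]; field_simp
    nlinarith
  -- The margins r/4 + r/4 < r keep the δ-ball about each x + z v with |z| = r off the hyperplane,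
  -- while R/4 keeps it inside Ω.
  set δ : ℝ := min (R / 4) (r / (4 * (‖L‖ + 1))) with hδ
  have hδ0 : 0 < δ := by positivity
  have hδR : δ ≤ R / 4 := min_le_left _ _
  have hδL : ‖L‖ * δ ≤ r / 4 := by
    have h1 : δ * (4 * (‖L‖ + 1)) ≤ r := (le_div_iff₀ (by positivity)).1 (min_le_right _ _)
    nlinarith
  have hLx : ∀ x ∈ ball x₀ δ, ‖L x‖ ≤ r / 4 := by
    intro x hx
    have : L x = L (x - x₀) := by rw [map_sub, hL, sub_zero]
    rw [this]
    refine (L.le_opNorm _).trans (le_trans ?_ hδL)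
    exact mul_le_mul_of_nonneg_left (mem_ball_iff_norm.1 hx).le (norm_nonneg _)
  have hmemΩ : ∀ x ∈ ball x₀ δ, ∀ z : ℂ, ‖z‖ ≤ r → ball (x + z • v) δ ⊆ Ω := by
    intro x hx z hz y hy
    apply hball
    rw [mem_ball_iff_norm] at *
    have : y - x₀ = (y - (x + z • v)) + (x - x₀) + z • v := by abel
    rw [this]
    have h1 := norm_add₃_le (a := y - (x + z • v)) (b := x - x₀) (c := z • v)
    have h2 : ‖z • v‖ ≤ r * ‖v‖ := by
      rw [norm_smul]; exact mul_le_mul_of_nonneg_right hz (norm_nonneg _)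
    linarith
  have hmem : ∀ x ∈ ball x₀ δ, ∀ z : ℂ, ‖z‖ = r → ball (x + z • v) δ ⊆ Ω ∩ {x | L x ≠ 0} := by
    intro x hx z hz y hy
    refine ⟨hmemΩ x hx z hz.le hy, fun h0 => ?_⟩
    have h1 : L y = L (y - (x + z • v)) + L x + z := by simp [hv]; ring
    rw [h0] at h1
    have h2 : z = -(L (y - (x + z • v)) + L x) := by linear_combination -h1
    have h3 : ‖z‖ ≤ ‖L (y - (x + z • v))‖ + ‖L x‖ := by
      conv_lhs => rw [h2]
      rw [norm_neg]; exact norm_add_le _ _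
    have h4 : ‖L (y - (x + z • v))‖ ≤ r / 4 := by
      refine (L.le_opNorm _).trans (le_trans ?_ hδL)
      exact mul_le_mul_of_nonneg_left (mem_ball_iff_norm.1 hy).le (norm_nonneg _)
    have h5 := hLx x hx
    linarith
  have hdiff : ∀ x ∈ ball x₀ δ, ∀ z : ℂ, ‖z‖ = r → DifferentiableAt ℂ f (x + z • v) :=
    fun x hx z hz => hf.differentiableAt (hopen.mem_nhds (hmem x hx z hz (mem_ball_self hδ0)))
  have hnc : ∀ θ : ℝ, ‖circleMap 0 r θ‖ = r := fun θ => by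
    simpa using (norm_circleMap_zero r θ).trans (abs_of_pos hr0)
  have hcont : ∀ x ∈ ball x₀ δ, Continuous fun θ : ℝ => f (x + circleMap 0 r θ • v) := by
    intro x hx
    rw [continuous_iff_continuousAt]
    intro θ
    exact ContinuousAt.comp (f := fun θ : ℝ => x + circleMap 0 r θ • v)
      (hdiff x hx _ (hnc θ)).continuousAt
      (Continuous.continuousAt (by have := continuous_circleMap 0 r; fun_prop))
  -- The extension is the mean of f over a circle in direction `v`. That circle avoids the
  -- hyperplane even when x lies on it, so one may differentiate under the integral.
  refine ⟨fun x => Real.circleAverage (fun z => f (x + z • v)) 0 r, δ, hδ0, ?_, ?_, ?_⟩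
  · exact (ball_subset_ball (by linarith)).trans hball
  · intro x hx
    have hd : DifferentiableAt ℂ
        (fun x => ∫ θ in (0 : ℝ)..2 * Real.pi, f (x + circleMap 0 r θ • v)) x := by
      let : MeasurableSpace E := borel E
      have : BorelSpace E := ⟨rfl⟩
      refine (intervalIntegral.hasFDerivAt_integral_of_dominated_of_fderiv_le (𝕜 := ℂ)
        (F' := fun x θ => fderiv ℂ f (x + circleMap 0 r θ • v)) (bound := fun _ => 2 * M / δ)
        (isOpen_ball.mem_nhds hx) ?_ ?_ ?_ ?_ ?_ ?_).differentiableAt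
      · filter_upwards [isOpen_ball.mem_nhds hx] with y hy
        exact (hcont y hy).aestronglyMeasurable
      · exact (hcont x hx).intervalIntegrable _ _
      · have : FiniteDimensional ℂ (E →L[ℂ] ℂ) := inferInstance
        have : ProperSpace (E →L[ℂ] ℂ) := FiniteDimensional.proper ℂ _
        refine Measurable.aestronglyMeasurable ?_
        refine (measurable_fderiv ℂ f).comp (Continuous.measurable ?_)
        have := continuous_circleMap 0 r
        fun_prop
      -- Cauchy's estimate on a δ-ball, where `f` varies by at most 2M, gives the dominating
      -- constant.
      · refine Eventually.of_forall fun θ _ y hy => ?_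
        have hsub := hmem y hy _ (hnc θ)
        refine norm_fderiv_le_div_of_mapsTo_ball (hf.mono hsub) (fun w hw => ?_) hδ0
        have h1 := hsub hw
        have h2 := hsub (mem_ball_self hδ0)
        rw [mem_closedBall, dist_eq_norm]
        have := norm_sub_le (f w) (f (y + circleMap 0 r θ • v))
        have := hM _ h1.1 h1.2
        have := hM _ h2.1 h2.2
        linarith
      · exact intervalIntegrable_const
      · refine Eventually.of_forall fun θ _ y hy => ?_
        have := (hdiff y hy _ (hnc θ)).hasFDerivAt.comp y
          ((hasFDerivAt_id (𝕜 := ℂ) y).add_const (circleMap 0 r θ • v))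
        rwa [ContinuousLinearMap.comp_id] at this
    simp only [Real.circleAverage_def]
    exact hd.const_smul ((2 * Real.pi)⁻¹ : ℝ)
  · intro x hx hLx0
    have hz1 : ‖-L x‖ < r := by rw [norm_neg]; linarith [hLx x hx]
    set z₁ := -L x with hz₁
    set s : Set ℂ := {z | x + z • v ∈ Ω} with hs
    have hso : IsOpen s := hΩ.preimage (by fun_prop)
    have hsub : closedBall 0 r ⊆ s := fun z hz =>
      hmemΩ x hx z (by simpa using hz) (mem_ball_self hδ0)
    set h : ℂ → ℂ := fun z => f (x + z • v) with hh
    have hne : ∀ z, z ≠ z₁ → L (x + z • v) ≠ 0 := by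
      intro z hz h0
      apply hz
      simp [hv] at h0
      rw [hz₁]
      linear_combination h0
    -- On the line x + z v the only bad point is z = -L x. It is removable, and the mean value
    -- property then returns the value at z = 0.
    have hd := differentiableOn_update_limUnder_of_bddAbove (f := h) (c := z₁)
      (hso.mem_nhds (hsub (by simpa using hz1.le)))
      (hf.comp (by fun_prop) fun z hz => ⟨hz.1, hne z hz.2⟩)
      ⟨M, by rintro _ ⟨z, hz, rfl⟩; exact hM _ hz.1 (hne z hz.2)⟩
    set h' := Function.update h z₁ (limUnder (𝓝[≠] z₁) h)
    have h1 : Real.circleAverage h 0 r = Real.circleAverage h' 0 r := by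
      apply Real.circleAverage_congr_sphere
      intro z hz
      refine (Function.update_of_ne ?_ _ _).symm
      rintro rfl
      rw [mem_sphere_zero_iff_norm, abs_of_pos hr0] at hz
      exact hz1.ne hz
    change Real.circleAverage h 0 r = _
    rw [h1, DiffContOnCl.circleAverage]
    · have h00 : (0 : ℂ) ≠ z₁ := by simpa [hz₁] using hLx0
      rw [show h' 0 = h 0 from Function.update_of_ne h00 _ _]
      simp [hh]
    · rw [abs_of_pos hr0]
      exact (hd.mono ((closure_ball_subset_closedBall).trans hsub)).diffContOnCl

/-- **Riemann's extension theorem** across a hyperplane. -/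
theorem exists_differentiableOn_extension {f : E → ℂ} {Ω : Set E} (hΩ : IsOpen Ω)
    {L : E →L[ℂ] ℂ} {v : E} (hv : L v = 1) {M : ℝ}
    (hf : DifferentiableOn ℂ f (Ω ∩ {x | L x ≠ 0})) (hM : ∀ x ∈ Ω, L x ≠ 0 → ‖f x‖ ≤ M) :
    ∃ F : E → ℂ, DifferentiableOn ℂ F Ω ∧ (∀ x ∈ Ω, L x ≠ 0 → F x = f x) ∧
      ∀ x ∈ Ω, ‖F x‖ ≤ M := by
  classical
  have hopen : IsOpen (Ω ∩ {x | L x ≠ 0}) :=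
    hΩ.inter (isOpen_ne_fun L.continuous continuous_const)
  have hneBot : ∀ x, L x = 0 → (𝓝[{x | L x ≠ 0}] x).NeBot := by
    intro x hx
    have h1 : Tendsto (fun z : ℂ => x + z • v) (𝓝[≠] 0) (𝓝[{x | L x ≠ 0}] x) := by
      refine tendsto_nhdsWithin_of_tendsto_nhds_of_eventually_within _ ?_ ?_
      · have : Tendsto (fun z : ℂ => x + z • v) (𝓝 0) (𝓝 (x + (0 : ℂ) • v)) :=
          Continuous.tendsto (by fun_prop) 0
        rw [zero_smul, add_zero] at this
        exact this.mono_left nhdsWithin_le_nhds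
      · filter_upwards [self_mem_nhdsWithin] with z hz
        simpa [hx, hv] using hz
    exact h1.neBot
  -- Defining the values on the hyperplane as limits makes the local extensions agree, since the
  -- complement accumulates at every point of it.
  set F : E → ℂ := fun x => if L x ≠ 0 then f x else limUnder (𝓝[{x | L x ≠ 0}] x) f with hF
  have hFf : ∀ x, L x ≠ 0 → F x = f x := fun x hx => if_pos hx
  have hloc : ∀ x₀ ∈ Ω, L x₀ = 0 → DifferentiableAt ℂ F x₀ := by
    intro x₀ hx₀ hL
    obtain ⟨G, δ, hδ, hsub, hG, hGf⟩ := exists_differentiableAt_extension_nhds hΩ hv hf hM hx₀ hL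
    have hEq : ∀ x ∈ ball x₀ δ, F x = G x := by
      intro x hx
      by_cases hx0 : L x = 0
      · have : (𝓝[{x | L x ≠ 0}] x).NeBot := hneBot x hx0
        have hlim : Tendsto f (𝓝[{x | L x ≠ 0}] x) (𝓝 (G x)) := by
          refine Tendsto.congr' ?_ ((hG x hx).continuousAt.tendsto.mono_left nhdsWithin_le_nhds)
          filter_upwards [self_mem_nhdsWithin,
            mem_nhdsWithin_of_mem_nhds (isOpen_ball.mem_nhds hx)] with y hy hy'
          exact hGf y hy' hy
        rw [hF]
        simp only [hx0, ne_eq, not_true_eq_false, if_false]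
        exact hlim.limUnder_eq
      · rw [hFf x hx0, hGf x hx hx0]
    refine (hG x₀ (mem_ball_self hδ)).congr_of_eventuallyEq ?_
    filter_upwards [ball_mem_nhds x₀ hδ] with x hx using hEq x hx
  have hd : ∀ x ∈ Ω, DifferentiableAt ℂ F x := by
    intro x hx
    by_cases h0 : L x = 0
    · exact hloc x hx h0
    · refine (hf.differentiableAt (hopen.mem_nhds ⟨hx, h0⟩)).congr_of_eventuallyEq ?_
      filter_upwards [hopen.mem_nhds ⟨hx, h0⟩] with y hy using hFf y hy.2
  refine ⟨F, fun x hx => (hd x hx).differentiableWithinAt, fun x _ => hFf x, fun x hx => ?_⟩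
  by_cases h0 : L x = 0
  · have := hneBot x h0
    refine le_of_tendsto ((hd x hx).continuousAt.norm.tendsto.mono_left
      (nhdsWithin_le_nhds (s := {x | L x ≠ 0}))) ?_
    filter_upwards [self_mem_nhdsWithin, mem_nhdsWithin_of_mem_nhds (hΩ.mem_nhds hx)] with y hy hy'
    rw [hFf y hy]
    exact hM y hy' hy
  · rw [hFf x h0]
    exact hM x hx h0

end Removable

/-! ### Periodic functions on half-planes and extension to polydiscs -/

section Domains
open Complex Metric Set Filter Topology Function.Periodic

variable {m N : ℕ}

theorem isOpen_forall {X ι : Type*} [TopologicalSpace X] [Finite ι] {p : ι → X → Prop}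
    (h : ∀ i, IsOpen {x | p i x}) : IsOpen {x | ∀ i, p i x} := by
  have : {x | ∀ i, p i x} = ⋂ i, {x | p i x} := by ext; simp
  rw [this]
  exact isOpen_iInter_of_finite h

theorem isOpen_halfPlanesTimesDiscs : IsOpen (halfPlanesTimesDiscs m N) :=
  (isOpen_forall fun _ => isOpen_lt (by fun_prop) (by fun_prop)).inter
    (isOpen_forall fun _ => isOpen_lt (by fun_prop) (by fun_prop))

theorem isOpen_discsTimesDiscs : IsOpen (discsTimesDiscs m N) :=
  (isOpen_forall fun _ => isOpen_lt (by fun_prop) (by fun_prop)).inter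
    (isOpen_forall fun _ => isOpen_lt (by fun_prop) (by fun_prop))

theorem isPreconnected_discsTimesDiscs : IsPreconnected (discsTimesDiscs m N) := by
  have : discsTimesDiscs m N =
      (univ.pi fun _ : Fin m => ball (0 : ℂ) 1) ×ˢ (univ.pi fun _ : Fin N => ball (0 : ℂ) 1) := by
    ext x
    simp [discsTimesDiscs]
  rw [this]
  exact (((convex_pi fun _ _ => convex_ball (0 : ℂ) 1).prod
    (convex_pi fun _ _ => convex_ball (0 : ℂ) 1) : Convex ℝ _)).isPreconnected

/-- The complement of the coordinate hyperplanes in `𝔼^m × 𝔼^N`. -/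
def puncturedDiscs (m N : ℕ) : Set ((Fin m → ℂ) × (Fin N → ℂ)) :=
  {x | x ∈ discsTimesDiscs m N ∧ ∀ i, x.1 i ≠ 0}

theorem isOpen_puncturedDiscs : IsOpen (puncturedDiscs m N) :=
  isOpen_discsTimesDiscs.inter
    (isOpen_forall fun _ => isOpen_ne_fun (by fun_prop) continuous_const)

theorem exists_mem_puncturedDiscs : ∃ x, x ∈ puncturedDiscs m N :=
  ⟨(fun _ => 1 / 2, fun _ => 0), ⟨fun _ => by norm_num, fun _ => by simp⟩, fun _ => by norm_num⟩

theorem subset_closure_puncturedDiscs :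
    discsTimesDiscs m N ⊆ closure (puncturedDiscs m N) := by
  intro x hx
  have hlim : Tendsto (fun s : ℂ => (x.1 + fun _ => s, x.2)) (𝓝[≠] 0) (𝓝 x) := by
    have : Tendsto (fun s : ℂ => (x.1 + fun _ => s, x.2)) (𝓝 0)
        (𝓝 (x.1 + fun _ => (0 : ℂ), x.2)) := Continuous.tendsto (by fun_prop) 0
    have e : (x.1 + fun _ => (0 : ℂ), x.2) = x := by ext <;> simp
    rw [e] at this
    exact this.mono_left nhdsWithin_le_nhds
  refine mem_closure_of_tendsto hlim ?_
  have h1 := hlim.eventually (isOpen_discsTimesDiscs.mem_nhds hx)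
  have h2 : ∀ᶠ s : ℂ in 𝓝[≠] 0, ∀ i, x.1 i + s ≠ 0 := by
    rw [eventually_all]
    intro i
    by_cases h : x.1 i = 0
    · filter_upwards [self_mem_nhdsWithin] with s hs
      simpa [h] using hs
    · have : Tendsto (fun s : ℂ => x.1 i + s) (𝓝[≠] 0) (𝓝 (x.1 i + 0)) :=
        (Continuous.tendsto (by fun_prop) 0).mono_left nhdsWithin_le_nhds
      rw [add_zero] at this
      exact this.eventually_ne h
  filter_upwards [h1, h2] with s hs1 hs2 using ⟨hs1, hs2⟩

/-- A bounded holomorphic function extends across the coordinate hyperplanes. -/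
theorem exists_extension_of_bounded {f : (Fin m → ℂ) × (Fin N → ℂ) → ℂ}
    (hf : DifferentiableOn ℂ f (puncturedDiscs m N)) {M : ℝ}
    (hM : ∀ x ∈ puncturedDiscs m N, ‖f x‖ ≤ M) :
    ∃ F, DifferentiableOn ℂ F (discsTimesDiscs m N) ∧ (∀ x ∈ puncturedDiscs m N, F x = f x) ∧
      ∀ x ∈ discsTimesDiscs m N, ‖F x‖ ≤ M := by
  classical
  -- Fill in the hyperplanes indexed by `S` one at a time; the bound `M` is carried along because
  -- the next extension needs it.
  have key : ∀ S : Finset (Fin m), ∃ F, DifferentiableOn ℂ F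
      {x | x ∈ discsTimesDiscs m N ∧ ∀ i ∉ S, x.1 i ≠ 0} ∧ (∀ x ∈ puncturedDiscs m N, F x = f x) ∧
      ∀ x ∈ {x | x ∈ discsTimesDiscs m N ∧ ∀ i ∉ S, x.1 i ≠ 0}, ‖F x‖ ≤ M := by
    intro S
    induction S using Finset.induction_on with
    | empty => exact ⟨f, by simpa [puncturedDiscs] using hf, fun _ _ => rfl,
        by simpa [puncturedDiscs] using hM⟩
    | insert i S hi ih =>
      obtain ⟨F, hF, hFf, hFM⟩ := ih
      have hopen : IsOpen {x : (Fin m → ℂ) × (Fin N → ℂ) |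
          x ∈ discsTimesDiscs m N ∧ ∀ j ∉ insert i S, x.1 j ≠ 0} := by
        refine isOpen_discsTimesDiscs.inter (isOpen_forall fun j => ?_)
        by_cases hj : j ∈ insert i S
        · simp [hj]
        · simpa [hj] using isOpen_ne_fun (by fun_prop) continuous_const
      have hmem : ∀ x : (Fin m → ℂ) × (Fin N → ℂ),
          (x ∈ discsTimesDiscs m N ∧ ∀ j ∉ insert i S, x.1 j ≠ 0) → x.1 i ≠ 0 →
          x ∈ discsTimesDiscs m N ∧ ∀ j ∉ S, x.1 j ≠ 0 := by
        intro x hx hxi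
        refine ⟨hx.1, fun j hj => ?_⟩
        by_cases h : j = i
        · rwa [h]
        · exact hx.2 j (by simp [h, hj])
      obtain ⟨G, hG, hGF, hGM⟩ := exists_differentiableOn_extension hopen (f := F) (M := M)
        (L := (ContinuousLinearMap.proj i).comp
          (ContinuousLinearMap.fst ℂ (Fin m → ℂ) (Fin N → ℂ))) (v := (Pi.single i 1, 0)) (by simp)
        (hF.mono fun x hx => hmem x hx.1 hx.2) (fun x hx hxi => hFM x (hmem x hx hxi))
      refine ⟨G, hG, fun x hx => ?_, hGM⟩
      rw [hGF x ⟨hx.1, fun j _ => hx.2 j⟩ (hx.2 i), hFf x hx]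
  simpa using key Finset.univ

/-- A holomorphic function with non-negative imaginary part extends across the coordinate
hyperplanes. -/
theorem exists_extension_of_im_nonneg {f : (Fin m → ℂ) × (Fin N → ℂ) → ℂ}
    (hf : DifferentiableOn ℂ f (puncturedDiscs m N))
    (him : ∀ x ∈ puncturedDiscs m N, 0 ≤ (f x).im) :
    ∃ F, DifferentiableOn ℂ F (discsTimesDiscs m N) ∧ ∀ x ∈ puncturedDiscs m N, F x = f x := by
  have hne : ∀ x ∈ puncturedDiscs m N, f x + I ≠ 0 := by
    intro x hx h
    have h1 := congrArg Complex.im h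
    simp at h1
    linarith [him x hx]
  obtain ⟨G, hG, hGf, hG1⟩ := exists_extension_of_bounded
    (f := fun x => (f x - I) / (f x + I)) (by
      simp only [div_eq_mul_inv]
      exact (hf.sub_const I).mul ((hf.add_const I).inv hne)) (M := 1)
    (fun x hx => by
      rw [norm_div]
      apply div_le_one_of_le₀ _ (norm_nonneg _)
      rw [← sq_le_sq₀ (norm_nonneg _) (norm_nonneg _), ← normSq_eq_norm_sq, ← normSq_eq_norm_sq,
        normSq_apply, normSq_apply]
      simp
      nlinarith [him x hx])
  -- The Cayley transform never equals 1 on the punctured domain. If its extension took the value 1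
  -- anywhere, the maximum principle would make it constantly 1.
  have hGne : ∀ x ∈ discsTimesDiscs m N, 1 - G x ≠ 0 := by
    intro x hx h
    have hGx : G x = 1 := (sub_eq_zero.1 h).symm
    have hconst := eqOn_of_isPreconnected_of_isMaxOn_norm isPreconnected_discsTimesDiscs
      isOpen_discsTimesDiscs hG hx (fun y hy => by
        change ‖G y‖ ≤ ‖G x‖
        rw [hGx, norm_one]
        exact hG1 y hy)
    obtain ⟨y, hy⟩ := exists_mem_puncturedDiscs (m := m) (N := N)
    have h1 : (f y - I) / (f y + I) = 1 := by rw [← hGf y hy, ← hGx]; exact hconst hy.1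
    rw [div_eq_one_iff_eq (hne y hy)] at h1
    have h2 := congrArg Complex.im h1
    simp at h2
    linarith
  refine ⟨fun x => I * (1 + G x) / (1 - G x), ?_, fun x hx => ?_⟩
  · simp only [div_eq_mul_inv]
    exact ((hG.const_add 1).const_mul I).mul ((hG.const_sub 1).inv hGne)
  · have h1 := hne x hx
    have h2 : 1 - G x = 2 * I / (f x + I) := by rw [hGf x hx]; field_simp; ring
    have h3 : 1 + G x = 2 * f x / (f x + I) := by rw [hGf x hx]; field_simp; ring
    simp only
    rw [h2, h3]
    field_simp [I_ne_zero]

theorem add_ofReal_mem_halfPlanesTimesDiscs {x : (Fin m → ℂ) × (Fin N → ℂ)}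
    (hx : x ∈ halfPlanesTimesDiscs m N) (r : Fin m → ℝ) :
    (x.1 + (fun i => (r i : ℂ)), x.2) ∈ halfPlanesTimesDiscs m N :=
  ⟨fun i => by simpa using hx.1 i, hx.2⟩

theorem single_ofReal (i : Fin m) (t : ℝ) :
    (Pi.single i (t : ℂ) : Fin m → ℂ) = fun j => ((Pi.single i t : Fin m → ℝ) j : ℂ) := by
  funext j
  by_cases h : j = i
  · subst h; simp
  · simp [h]

theorem add_single_mem_halfPlanesTimesDiscs {x : (Fin m → ℂ) × (Fin N → ℂ)}
    (hx : x ∈ halfPlanesTimesDiscs m N) (i : Fin m) (t : ℝ) :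
    (x.1 + Pi.single i (t : ℂ), x.2) ∈ halfPlanesTimesDiscs m N := by
  rw [single_ofReal]
  exact add_ofReal_mem_halfPlanesTimesDiscs hx _

theorem update_mem_halfPlanesTimesDiscs {x : (Fin m → ℂ) × (Fin N → ℂ)}
    (hx : x ∈ halfPlanesTimesDiscs m N) (i : Fin m) {z : ℂ} (hz : 0 < z.im) :
    (Function.update x.1 i z, x.2) ∈ halfPlanesTimesDiscs m N := by
  refine ⟨fun j => ?_, hx.2⟩
  by_cases h : j = i
  · subst h; simpa using hz
  · simpa [h] using hx.1 j

theorem update_add (x : Fin m → ℂ) (i : Fin m) (z w : ℂ) :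
    Function.update x i (z + w) = Function.update x i z + Pi.single i w := by
  funext j
  by_cases h : j = i
  · subst h; simp
  · simp [h]

theorem exists_mem_halfPlanesTimesDiscs : ∃ x, x ∈ halfPlanesTimesDiscs m N :=
  ⟨(fun _ => I, fun _ => 0), fun _ => by simp, fun _ => by simp⟩

theorem differentiableOn_update {g : (Fin m → ℂ) × (Fin N → ℂ) → ℂ}
    (hg : DifferentiableOn ℂ g (halfPlanesTimesDiscs m N)) {x : (Fin m → ℂ) × (Fin N → ℂ)}
    (hx : x ∈ halfPlanesTimesDiscs m N) (i : Fin m) :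
    DifferentiableOn ℂ (fun z => g (Function.update x.1 i z, x.2)) {z | 0 < z.im} := by
  refine hg.comp (f := fun z => (Function.update x.1 i z, x.2)) ?_
    fun z hz => update_mem_halfPlanesTimesDiscs hx i hz
  have : Differentiable ℂ fun z => Function.update x.1 i z := by
    have e : (fun z => Function.update x.1 i z) = fun z =>
        Function.update x.1 i 0 + (ContinuousLinearMap.single ℂ (fun _ : Fin m => ℂ) i) z := by
      funext z
      simpa using update_add x.1 i 0 z
    rw [e]
    fun_prop
  fun_prop

/-- The several variables version of `im_ge_of_translate`. -/
theorem im_ge_sum_of_translate {g : (Fin m → ℂ) × (Fin N → ℂ) → ℂ}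
    (hg : DifferentiableOn ℂ g (halfPlanesTimesDiscs m N))
    (him : ∀ x ∈ halfPlanesTimesDiscs m N, 0 ≤ (g x).im) {l : ℝ} (hl : 0 < l) {t : Fin m → ℝ}
    (hgt : ∀ i, ∀ x ∈ halfPlanesTimesDiscs m N,
      g (x.1 + Pi.single i (l : ℂ), x.2) = g x + l * t i) :
    (∀ i, 0 ≤ t i) ∧ ∀ x ∈ halfPlanesTimesDiscs m N, ∑ i, t i * (x.1 i).im ≤ (g x).im := by
  classical
  refine ⟨fun i => ?_, ?_⟩
  · obtain ⟨x, hx⟩ := exists_mem_halfPlanesTimesDiscs (m := m) (N := N)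
    refine (im_ge_of_translate (differentiableOn_update hg hx i)
      (fun z hz => him _ (update_mem_halfPlanesTimesDiscs hx i hz)) hl fun z hz => ?_).1
    rw [update_add]
    exact hgt i _ (update_mem_halfPlanesTimesDiscs hx i hz)
  · have key : ∀ S : Finset (Fin m), ∀ x ∈ halfPlanesTimesDiscs m N,
        ∑ i ∈ S, t i * (x.1 i).im ≤ (g x).im := by
      intro S
      induction S using Finset.induction_on with
      | empty => simpa using him
      | insert i S hi ih =>
        intro x hx
        have hsum : ∀ z : ℂ, ∑ j ∈ S, t j * (Function.update x.1 i z j).im =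
            ∑ j ∈ S, t j * (x.1 j).im := by
          intro z
          refine Finset.sum_congr rfl fun j hj => ?_
          rw [Function.update_of_ne (by rintro rfl; exact hi hj)]
        -- The terms already obtained are constant in the i-th variable, so subtracting them keeps
        -- the translation law for that variable.
        have := (im_ge_of_translate
          (g := fun z => g (Function.update x.1 i z, x.2) - (∑ j ∈ S, t j * (x.1 j).im : ℝ) * I)
          ((differentiableOn_update hg hx i).sub_const _) (fun z hz => by
            have := ih _ (update_mem_halfPlanesTimesDiscs hx i hz)
            rw [hsum] at this
            simp only [sub_im, mul_im, ofReal_re, I_im, ofReal_im, I_re, mul_zero, add_zero,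
              mul_one]
            linarith) hl (t := t i) fun z hz => by
            rw [update_add, hgt i _ (update_mem_halfPlanesTimesDiscs hx i hz)]
            ring).2 (x.1 i) (hx.1 i)
        simp only [Function.update_eq_self, sub_im, mul_im, ofReal_re, I_im, ofReal_im, I_re,
          mul_zero, add_zero, mul_one] at this
        rw [Finset.sum_insert hi]
        linarith
    exact key Finset.univ

/-- The map `(τ, w) ↦ (exp (2πi τ / l), w)`. -/
noncomputable def qMap (l : ℝ) (x : (Fin m → ℂ) × (Fin N → ℂ)) : (Fin m → ℂ) × (Fin N → ℂ) :=
  (fun i => qParam l (x.1 i), x.2)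

theorem qMap_mem_puncturedDiscs {l : ℝ} (hl : 0 < l) {x : (Fin m → ℂ) × (Fin N → ℂ)}
    (hx : x ∈ halfPlanesTimesDiscs m N) : qMap l x ∈ puncturedDiscs m N :=
  ⟨⟨fun i => norm_qParam_lt_one hl (hx.1 i), hx.2⟩, fun _ => qParam_ne_zero _⟩

theorem invQParam_mem {l : ℝ} (hl : 0 < l) {y : (Fin m → ℂ) × (Fin N → ℂ)}
    (hy : y ∈ puncturedDiscs m N) :
    ((fun i => invQParam l (y.1 i), y.2) : (Fin m → ℂ) × (Fin N → ℂ))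
      ∈ halfPlanesTimesDiscs m N := by
  refine ⟨fun i => ?_, hy.1.2⟩
  rw [im_invQParam]
  have h1 := Real.log_neg (norm_pos_iff.2 (hy.2 i)) (hy.1.1 i)
  have h2 : -l / (2 * Real.pi) < 0 := div_neg_of_neg_of_pos (by linarith) (by positivity)
  exact mul_pos_of_neg_of_neg h2 h1

theorem apply_add_int_mul {f : (Fin m → ℂ) × (Fin N → ℂ) → ℂ} {l : ℝ}
    (hper : ∀ i, ∀ x ∈ halfPlanesTimesDiscs m N, f (x.1 + Pi.single i (l : ℂ), x.2) = f x)
    {x : (Fin m → ℂ) × (Fin N → ℂ)} (hx : x ∈ halfPlanesTimesDiscs m N) (n : Fin m → ℤ) :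
    f (fun i => x.1 i + n i * l, x.2) = f x := by
  classical
  have hnat : ∀ (i : Fin m) (k : ℕ), ∀ x ∈ halfPlanesTimesDiscs m N,
      f (x.1 + Pi.single i (((k : ℝ) * l : ℝ) : ℂ), x.2) = f x := by
    intro i k
    induction k with
    | zero => simp
    | succ k ih =>
      intro x hx
      rw [← ih x hx, ← hper i _ (add_single_mem_halfPlanesTimesDiscs hx i (k * l))]
      congr 2
      simp only [add_assoc]
      rw [← Pi.single_add]
      congr 2
      push_cast; ring
  have hint : ∀ (i : Fin m) (k : ℤ), ∀ x ∈ halfPlanesTimesDiscs m N,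
      f (x.1 + Pi.single i (((k : ℝ) * l : ℝ) : ℂ), x.2) = f x := by
    intro i k x hx
    obtain ⟨k, rfl | rfl⟩ := k.eq_nat_or_neg
    · exact_mod_cast hnat i k x hx
    · rw [← hnat i k _ (add_single_mem_halfPlanesTimesDiscs hx i _)]
      congr 1
      ext j
      · simp [add_assoc, Pi.single_neg]
      · rfl
  have key : ∀ S : Finset (Fin m), ∀ x ∈ halfPlanesTimesDiscs m N,
      f (x.1 + ∑ i ∈ S, Pi.single i (((n i : ℝ) * l : ℝ) : ℂ), x.2) = f x := by
    intro S
    induction S using Finset.induction_on with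
    | empty => simp
    | insert i S hi ih =>
      intro x hx
      rw [Finset.sum_insert hi, ← add_assoc]
      rw [← hint i (n i) x hx]
      exact ih _ (add_single_mem_halfPlanesTimesDiscs hx i _)
  rw [← key Finset.univ x hx, Finset.univ_sum_single]
  congr 2
  funext i
  simp

/-- Holomorphic functions of non-negative imaginary part on `ℍ^m × 𝔼^N` that are periodic in the
variables of `ℍ^m` are holomorphic functions on `𝔼^m × 𝔼^N`. -/
theorem exists_eq_comp_qMap {f : (Fin m → ℂ) × (Fin N → ℂ) → ℂ}
    (hf : DifferentiableOn ℂ f (halfPlanesTimesDiscs m N))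
    (him : ∀ x ∈ halfPlanesTimesDiscs m N, 0 ≤ (f x).im) {l : ℝ} (hl : 0 < l)
    (hper : ∀ i, ∀ x ∈ halfPlanesTimesDiscs m N, f (x.1 + Pi.single i (l : ℂ), x.2) = f x) :
    ∃ F, DifferentiableOn ℂ F (discsTimesDiscs m N) ∧
      ∀ x ∈ halfPlanesTimesDiscs m N, f x = F (qMap l x) := by
  set g : (Fin m → ℂ) × (Fin N → ℂ) → ℂ := fun y => f (fun i => invQParam l (y.1 i), y.2) with hg
  have hgf : ∀ x ∈ halfPlanesTimesDiscs m N, g (qMap l x) = f x := by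
    intro x hx
    choose n hn using fun i => qParam_left_inv_mod_period hl.ne' (x.1 i)
    rw [← apply_add_int_mul hper hx n]
    simp only [hg, qMap, hn]
  have hgd : DifferentiableOn ℂ g (puncturedDiscs m N) := by
    intro y₀ hy₀
    -- Near `y₀`, log(y / y₀) + log y₀ is a holomorphic branch of the logarithm, even where the
    -- principal branch jumps; periodicity makes f independent of the choice.
    set σ : (Fin m → ℂ) × (Fin N → ℂ) → (Fin m → ℂ) × (Fin N → ℂ) := fun y =>
      (fun i => l / (2 * Real.pi * I) * (log (y.1 i / y₀.1 i) + log (y₀.1 i)), y.2) with hσ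
    have hσ0 : σ y₀ = (fun i => invQParam l (y₀.1 i), y₀.2) := by
      simp only [hσ, invQParam, div_self (hy₀.2 _), log_one, zero_add]
    have hσd : DifferentiableAt ℂ σ y₀ := by
      refine DifferentiableAt.prodMk (differentiableAt_pi.2 fun i => ?_) (by fun_prop)
      refine DifferentiableAt.const_mul (DifferentiableAt.add_const _ (DifferentiableAt.clog ?_ ?_)) _
      · have := hy₀.2 i
        fun_prop (disch := assumption)
      · rw [div_self (hy₀.2 i)]; exact one_mem_slitPlane
    have hmem : σ y₀ ∈ halfPlanesTimesDiscs m N := by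
      rw [hσ0]; exact invQParam_mem hl hy₀
    have hcomp : DifferentiableAt ℂ (fun y => f (σ y)) y₀ :=
      DifferentiableAt.comp (f := σ) y₀
        (hf.differentiableAt (isOpen_halfPlanesTimesDiscs.mem_nhds hmem)) hσd
    refine (hcomp.congr_of_eventuallyEq ?_).differentiableWithinAt
    filter_upwards [hσd.continuousAt.preimage_mem_nhds
      (isOpen_halfPlanesTimesDiscs.mem_nhds hmem), isOpen_puncturedDiscs.mem_nhds hy₀] with y hy hy'
    rw [← hgf (σ y) hy]
    congr 1
    ext i
    · simp only [qMap, hσ, qParam]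
      have h1 : (2 * Real.pi * I : ℂ) ≠ 0 := two_pi_I_ne_zero
      have h2 : (l : ℂ) ≠ 0 := by exact_mod_cast hl.ne'
      rw [← mul_assoc, mul_div_cancel₀ _ h1, mul_div_cancel_left₀ _ h2, exp_add,
        exp_log (div_ne_zero (hy'.2 i) (hy₀.2 i)), exp_log (hy₀.2 i), div_mul_cancel₀ _ (hy₀.2 i)]
    · rfl
  obtain ⟨F, hF, hFg⟩ := exists_extension_of_im_nonneg hgd fun y hy => him _ (invQParam_mem hl hy)
  exact ⟨F, hF, fun x hx => by rw [hFg _ (qMap_mem_puncturedDiscs hl hx), hgf x hx]⟩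

theorem exists_qMap_eq {l : ℝ} (hl : 0 < l) {y : (Fin m → ℂ) × (Fin N → ℂ)}
    (hy : y ∈ puncturedDiscs m N) : ∃ x ∈ halfPlanesTimesDiscs m N, qMap l x = y :=
  ⟨_, invQParam_mem hl hy, by
    ext i
    · exact qParam_right_inv hl.ne' (hy.2 i)
    · rfl⟩

end Domains

/-! ### Coordinates and the boundary alternative -/

section Assembly
open Complex Set Filter Topology

variable {K : Type*} [AddCommGroup K]

theorem complexify_add_smul (φ χ : ℝ ⊗[ℤ] K →ₗ[ℝ] ℝ) (c : ℝ) (Z : ℂ ⊗[ℤ] K) :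
    complexify (φ + c • χ) Z = complexify φ Z + c * complexify χ Z := by
  induction Z with
  | zero => simp
  | add a b ha hb => simp only [map_add, ha, hb]; ring
  | tmul a x => simp only [complexify_tmul, LinearMap.add_apply, LinearMap.smul_apply]; simp; ring

theorem sum_complexify_coord_tmul {ι : Type*} [Fintype ι] (b : Module.Basis ι ℤ K)
    (Z : ℂ ⊗[ℤ] K) : ∑ j, complexify ((b.baseChange ℝ).coord j) Z ⊗ₜ[ℤ] b j = Z := by
  induction Z with
  | zero => simp
  | add x y hx hy => simp only [map_add, TensorProduct.add_tmul, Finset.sum_add_distrib, hx, hy]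
  | tmul a x =>
    conv_rhs => rw [← b.sum_repr x, TensorProduct.tmul_sum]
    refine Finset.sum_congr rfl fun j _ => ?_
    rw [complexify_tmul, coord_one_tmul, TensorProduct.tmul_smul, TensorProduct.smul_tmul',
      zsmul_eq_mul, mul_comm, ofReal_intCast]

theorem exists_apply_add_nat {m N : ℕ} {Ψ : (Fin m → ℂ) × (Fin N → ℂ) → ℂ ⊗[ℤ] K} {i : Fin m}
    {U : K ≃ₗ[ℤ] K} {T : K} (h : ∀ x ∈ halfPlanesTimesDiscs m N,
      Ψ (x.1 + Pi.single i 1, x.2) = scalarAct ℂ U (Ψ x) + 1 ⊗ₜ[ℤ] T) (n : ℕ) :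
    ∃ T' : K, ∀ x ∈ halfPlanesTimesDiscs m N,
      Ψ (x.1 + Pi.single i (n : ℂ), x.2) = scalarAct ℂ (U ^ n) (Ψ x) + 1 ⊗ₜ[ℤ] T' := by
  induction n with
  | zero => exact ⟨0, fun x _ => by simp [scalarAct_one]⟩
  | succ n ih =>
    obtain ⟨T', hT'⟩ := ih
    refine ⟨U T' + T, fun x hx => ?_⟩
    have h1 := h _ (add_single_mem_halfPlanesTimesDiscs hx i n)
    simp only [ofReal_natCast] at h1
    rw [hT' x hx, add_assoc x.1, ← Pi.single_add] at h1
    rw [Nat.cast_succ, h1, map_add, ← scalarAct_mul, ← pow_succ', TensorProduct.tmul_add, add_assoc]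
    simp [scalarAct]

variable [Module.Free ℤ K] [Module.Finite ℤ K]

omit [Module.Free ℤ K] in
/-- A holomorphic map from `𝔼^m × 𝔼^N` whose imaginary part lies in the closed cone takes values
either in the tube domain or in its boundary. -/
theorem mem_formCone_or_not_mem {Q : QuadraticForm ℤ K} (hB : IsHyperbolic (realBilin Q))
    {y₀ : ℝ ⊗[ℤ] K} (hy₀ : 0 < realBilin Q y₀ y₀) {m N : ℕ}
    {Ψ₀ : (Fin m → ℂ) × (Fin N → ℂ) → ℂ ⊗[ℤ] K}
    (hhol : IsHolomorphicOn Ψ₀ (discsTimesDiscs m N))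
    (hmem : ∀ x ∈ discsTimesDiscs m N, imPart (Ψ₀ x) ∈ closedFormCone (realBilin Q) y₀) :
    (∀ x ∈ discsTimesDiscs m N, imPart (Ψ₀ x) ∈ formCone (realBilin Q) y₀) ∨
      ∀ x ∈ discsTimesDiscs m N, imPart (Ψ₀ x) ∉ formCone (realBilin Q) y₀ := by
  rw [or_iff_not_imp_left]
  intro h x hx hxC
  push Not at h
  obtain ⟨x₁, hx₁, hx₁C⟩ := h
  set Y := imPart (Ψ₀ x₁) with hY
  have hYm := hmem x₁ hx₁
  -- A supporting functional at the boundary value `Y`: pairing with `Y` itself, which is then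
  -- isotropic, or with `y₀` when Y = 0. The modulus of exp(iφ) attains its maximum 1 there.
  obtain ⟨φ, hφY, hφnn, hφpos⟩ : ∃ φ : ℝ ⊗[ℤ] K →ₗ[ℝ] ℝ, φ Y = 0 ∧
      (∀ z ∈ closedFormCone (realBilin Q) y₀, 0 ≤ φ z) ∧
      ∀ z ∈ formCone (realBilin Q) y₀, 0 < φ z := by
    by_cases hY0 : Y = 0
    · exact ⟨realBilin Q y₀, by rw [hY0, map_zero], fun z hz => hz.2, fun z hz => hz.2⟩
    · have hpos : ∀ z ∈ formCone (realBilin Q) y₀, 0 < realBilin Q Y z := fun z hz => by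
        rw [hB.symm]; exact hB.pos_of_mem hy₀ hYm hY0 hz
      refine ⟨realBilin Q Y, ?_, fun z hz => ?_, hpos⟩
      · by_contra hne
        refine hx₁C ⟨lt_of_le_of_ne hYm.1 (Ne.symm hne), ?_⟩
        exact hB.pos_of_mem hy₀ hYm hY0 ⟨hy₀, hy₀⟩
      · rw [← closure_formCone hB hy₀] at hz
        exact closure_minimal (t := {z | 0 ≤ realBilin Q Y z}) (fun z hz => (hpos z hz).le)
          (isClosed_le continuous_const (continuous_functional _)) hz
  have hnorm : ∀ y, ‖cexp (I * complexify φ (Ψ₀ y))‖ = Real.exp (-φ (imPart (Ψ₀ y))) := by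
    intro y
    rw [norm_exp, ← complexify_im]
    simp
  have := norm_eqOn_of_isPreconnected_of_isMaxOn isPreconnected_discsTimesDiscs
    isOpen_discsTimesDiscs (f := fun y => cexp (I * complexify φ (Ψ₀ y)))
    ((hhol (complexify φ)).const_mul I).cexp hx₁ (fun y hy => by
      change ‖_‖ ≤ ‖_‖
      rw [hnorm, hnorm, ← hY, hφY, neg_zero, Real.exp_zero, Real.exp_le_one_iff, neg_nonpos]
      exact hφnn _ (hmem y hy)) hx
  simp only [Function.comp_apply, Function.const_apply] at this
  rw [hnorm, hnorm, ← hY, hφY, Real.exp_eq_exp, neg_inj] at this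
  exact (hφpos _ hxC).ne' this

end Assembly

end CurveLemma

/-! ### The main theorem -/

open CurveLemma

/-- The divisibility clause, with ℓ positive, encodes both finite order of every automorphism and
the identification of ℓ as the least common multiple of the orders. -/
theorem theorem3p1 {K : Type*} [AddCommGroup K] [Module.Free ℤ K] [Module.Finite ℤ K]
    (Q : QuadraticForm ℤ K) (hQ : CurveLemma.IsLorentzian Q)
    (Cplus : Set (ℝ ⊗[ℤ] K)) (hC : CurveLemma.IsPositiveCone Q Cplus)
    (m N : ℕ) (Ψ : (Fin m → ℂ) × (Fin N → ℂ) → ℂ ⊗[ℤ] K)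
    (hΨ_hol : CurveLemma.IsHolomorphicOn Ψ (CurveLemma.halfPlanesTimesDiscs m N))
    (hΨ_maps : Set.MapsTo Ψ (CurveLemma.halfPlanesTimesDiscs m N) (CurveLemma.tubeDomain Cplus))
    (U : Fin m → (K ≃ₗ[ℤ] K)) (hU : ∀ i, U i ∈ CurveLemma.discriminantKernel Q)
    (T : Fin m → K)
    (hΨ_equiv : ∀ i, ∀ x ∈ CurveLemma.halfPlanesTimesDiscs m N,
      Ψ (x.1 + Pi.single i 1, x.2) = CurveLemma.scalarAct ℂ (U i) (Ψ x) + 1 ⊗ₜ[ℤ] T i) :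
    ∃ ℓ : ℕ, 0 < ℓ ∧ (∀ n : ℕ, (∀ i, U i ^ n = 1) ↔ ℓ ∣ n) ∧
      ∃ (lam : Fin m → ℝ ⊗[ℤ] K) (Ψ₀ : (Fin m → ℂ) × (Fin N → ℂ) → ℂ ⊗[ℤ] K),
        (∀ i, lam i ∈ CurveLemma.rationalVectors K ∩ closure Cplus) ∧
        CurveLemma.IsHolomorphicOn Ψ₀ (CurveLemma.discsTimesDiscs m N) ∧
        ((∀ x ∈ CurveLemma.discsTimesDiscs m N, Ψ₀ x ∈ CurveLemma.tubeDomain Cplus) ∨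
          (∀ x ∈ CurveLemma.discsTimesDiscs m N,
            CurveLemma.imPart (Ψ₀ x) ∈ frontier Cplus)) ∧
        ∀ x ∈ CurveLemma.halfPlanesTimesDiscs m N,
          Ψ x = ∑ i, x.1 i • CurveLemma.realToComplex (lam i) +
            Ψ₀ (fun i => Complex.exp (2 * Real.pi * Complex.I * x.1 i / ℓ), x.2) := by
  classical
  have hB := hQ.isHyperbolic
  obtain ⟨y₀, hy₀, rfl⟩ := hC.exists_eq_formCone hB
  set B := realBilin Q with hBdef
  have hfin : ∀ i, ∃ l : ℕ, 0 < l ∧ U i ^ l = 1 := by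
    intro i
    obtain ⟨x, hx⟩ := exists_mem_halfPlanesTimesDiscs (m := m) (N := N)
    refine exists_pow_eq_one hB hy₀ (ψ := fun z => Ψ (Function.update x.1 i z, x.2))
      (fun φ => differentiableOn_update (hΨ_hol (complexify φ)) hx i)
      (fun z hz => hΨ_maps (update_mem_halfPlanesTimesDiscs hx i hz)) (hU i).1 (T i)
      fun z hz => ?_
    rw [update_add]
    exact hΨ_equiv i _ (update_mem_halfPlanesTimesDiscs hx i hz)
  -- For m = 0 this is the empty least common multiple, namely 1.
  set l := Finset.univ.lcm fun i => orderOf (U i) with hl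
  have hl0 : 0 < l := by
    refine Nat.pos_of_ne_zero fun h => ?_
    obtain ⟨i, -, hi⟩ := Finset.lcm_eq_zero_iff.1 h
    obtain ⟨k, hk, hk1⟩ := hfin i
    exact (orderOf_pos_iff.2 (isOfFinOrder_iff_pow_eq_one.2 ⟨k, hk, hk1⟩)).ne' hi
  have hlR : (0 : ℝ) < l := by exact_mod_cast hl0
  have hdvd : ∀ n : ℕ, (∀ i, U i ^ n = 1) ↔ l ∣ n := by
    intro n
    rw [hl, Finset.lcm_dvd_iff]
    simp [orderOf_dvd_iff_pow_eq_one]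
  refine ⟨l, hl0, hdvd, ?_⟩
  choose T' hT' using fun i => exists_apply_add_nat (hΨ_equiv i) l
  -- Since every Uᵢ^l is trivial, translating τᵢ by `l` adds exactly T'ᵢ, so dividing by `l` gives
  -- the linear coefficient.
  set lam : Fin m → ℝ ⊗[ℤ] K := fun i => (1 / l : ℝ) ⊗ₜ T' i with hlam
  have hg : ∀ (φ : ℝ ⊗[ℤ] K →ₗ[ℝ] ℝ) (i : Fin m), ∀ x ∈ halfPlanesTimesDiscs m N,
      complexify φ (Ψ (x.1 + Pi.single i ((l : ℝ) : ℂ), x.2)) =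
        complexify φ (Ψ x) + (l : ℝ) * (φ (lam i) : ℝ) := by
    intro φ i x hx
    rw [Complex.ofReal_natCast, hT' i x hx, (hdvd l).2 dvd_rfl i, scalarAct_one, map_add,
      complexify_one_tmul, hlam]
    simp only
    rw [map_tmul_eq φ (1 / l)]
    have : (l : ℂ) ≠ 0 := by exact_mod_cast hl0.ne'
    push_cast
    field_simp
  have hpos : ∀ w ∈ formCone B y₀, ∀ x ∈ halfPlanesTimesDiscs m N,
      0 ≤ (complexify (B w) (Ψ x)).im := by
    intro w hw x hx
    rw [complexify_im]
    exact (hB.pos_of_mem_formCone hy₀ (hΨ_maps hx) hw).le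
  have htrans := fun w hw =>
    im_ge_sum_of_translate (hΨ_hol (complexify (B w))) (hpos w hw) hlR (hg (B w))
  set f : (ℝ ⊗[ℤ] K →ₗ[ℝ] ℝ) → (Fin m → ℂ) × (Fin N → ℂ) → ℂ := fun φ x =>
    complexify φ (Ψ x - ∑ i, x.1 i • realToComplex (lam i)) with hf
  have hf' : ∀ φ x, f φ x = complexify φ (Ψ x) - ∑ i, x.1 i * (φ (lam i) : ℝ) := by
    intro φ x
    simp only [hf, map_sub, map_sum, map_smul, complexify_realToComplex, smul_eq_mul]
  have hfim : ∀ w ∈ formCone B y₀, ∀ x ∈ halfPlanesTimesDiscs m N, 0 ≤ (f (B w) x).im := by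
    intro w hw x hx
    rw [hf', Complex.sub_im, Complex.im_sum]
    have := (htrans w hw).2 x hx
    simp only [Complex.im_mul_ofReal, mul_comm (x.1 _).im]
    linarith
  have hcone : ∀ w ∈ formCone B y₀, ∃ F, DifferentiableOn ℂ F (discsTimesDiscs m N) ∧
      ∀ x ∈ halfPlanesTimesDiscs m N, f (B w) x = F (qMap l x) := by
    intro w hw
    refine exists_eq_comp_qMap ?_ (hfim w hw) hlR fun i x hx => ?_
    · rw [show f (B w) = fun x => complexify (B w) (Ψ x) - ∑ i, x.1 i * (B w (lam i) : ℝ) from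
        funext (hf' (B w))]
      refine (hΨ_hol (complexify (B w))).sub (Differentiable.differentiableOn ?_)
      fun_prop
    · rw [hf', hf', hg _ i x hx]
      simp only [Pi.add_apply, add_mul, Finset.sum_add_distrib]
      have : ∑ j, (Pi.single i ((l : ℝ) : ℂ) : Fin m → ℂ) j * (B w (lam j) : ℝ) =
          (l : ℝ) * (B w (lam i) : ℝ) := by
        rw [Finset.sum_eq_single i (fun j _ hj => by simp [hj]) (by simp)]
        simp
      rw [this]
      ring
  -- Write the representing vector as (c y₀ + w) - c y₀, a combination of two cone vectors.
  have hall : ∀ φ, ∃ F, DifferentiableOn ℂ F (discsTimesDiscs m N) ∧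
      ∀ x ∈ halfPlanesTimesDiscs m N, f φ x = F (qMap l x) := by
    intro φ
    obtain ⟨w, rfl⟩ := exists_realBilin_eq hB hy₀ φ
    obtain ⟨c, -, hcw⟩ := hB.exists_smul_add_mem hy₀ w
    obtain ⟨F₁, hF₁, hF₁'⟩ := hcone _ hcw
    obtain ⟨F₂, hF₂, hF₂'⟩ := hcone y₀ ⟨hy₀, hy₀⟩
    refine ⟨fun y => F₁ y - c * F₂ y, hF₁.sub (hF₂.const_mul _), fun x hx => ?_⟩
    simp only
    rw [← hF₁' x hx, ← hF₂' x hx, map_add, map_smul, add_comm]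
    simp only [hf]
    rw [complexify_add_smul]
    ring
  set b := Module.Free.chooseBasis ℤ K
  choose F hF hFf using fun j => hall ((b.baseChange ℝ).coord j)
  set Ψ₀ : (Fin m → ℂ) × (Fin N → ℂ) → ℂ ⊗[ℤ] K := fun y => ∑ j, F j y ⊗ₜ b j with hΨ₀
  have hΨΨ₀ : ∀ x ∈ halfPlanesTimesDiscs m N,
      Ψ x - ∑ i, x.1 i • realToComplex (lam i) = Ψ₀ (qMap l x) := by
    intro x hx
    rw [← sum_complexify_coord_tmul b (Ψ x - ∑ i, x.1 i • realToComplex (lam i)), hΨ₀]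
    exact Finset.sum_congr rfl fun j _ => by rw [← hFf j x hx]
  have hhol : IsHolomorphicOn Ψ₀ (discsTimesDiscs m N) := by
    intro φ
    have : ∀ y, φ (Ψ₀ y) = ∑ j, F j y * φ (1 ⊗ₜ b j) := by
      intro y
      rw [hΨ₀, map_sum]
      refine Finset.sum_congr rfl fun j _ => ?_
      rw [← smul_eq_mul, ← map_smul, TensorProduct.smul_tmul', smul_eq_mul, mul_one]
    simp only [this]
    exact DifferentiableOn.fun_sum fun j _ => (hF j).mul_const _
  have hmem : ∀ y ∈ discsTimesDiscs m N, imPart (Ψ₀ y) ∈ closedFormCone B y₀ := by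
    intro y hy
    refine hB.mem_closedFormCone hy₀ fun w hw => ?_
    rw [← complexify_im]
    -- A strictly negative imaginary part would persist at a nearby point of the punctured domain,
    -- where the sign is already known.
    by_contra! hneg
    have hcont : ContinuousAt (fun y => (complexify (B w) (Ψ₀ y)).im) y :=
      Complex.continuous_im.continuousAt.comp
        ((hhol (complexify (B w))).differentiableAt
          (isOpen_discsTimesDiscs.mem_nhds hy)).continuousAt
    obtain ⟨y', hy', hneg'⟩ := ((mem_closure_iff_frequently.1
      (subset_closure_puncturedDiscs hy)).and_eventually (hcont.eventually_lt_const hneg)).exists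
    obtain ⟨x, hx, rfl⟩ := exists_qMap_eq hlR hy'
    rw [← hΨΨ₀ x hx] at hneg'
    exact absurd (hfim w hw x hx) (not_le.2 hneg')
  refine ⟨lam, Ψ₀, fun i => ⟨⟨(1 / l : ℚ) ⊗ₜ T' i, ?_⟩, ?_⟩, hhol, ?_, fun x hx => ?_⟩
  · rw [ratToReal_tmul, hlam]
    push_cast
    rfl
  · rw [closure_formCone hB hy₀]
    exact hB.mem_closedFormCone hy₀ fun w hw => (htrans w hw).1 i
  · refine (mem_formCone_or_not_mem hB hy₀ hhol hmem).imp id fun h x hx => ?_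
    rw [frontier, (isOpen_formCone Q y₀).interior_eq, closure_formCone hB hy₀]
    exact ⟨hmem x hx, h x hx⟩
  · rw [← sub_eq_iff_eq_add', hΨΨ₀ x hx]
    simp [qMap, Function.Periodic.qParam]
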